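/- Graphs are undirected multigraphs on $\{1,\dots,n\}$ (self-loops and multiple edges allowed; a self-loop adds $2$ to the degree). Each edge $i-j$ is replaced by the directed edges $i\to j$ and $j\to i$. For a graph $G$ with degrees $D_1,\dots,D_n$ put $L_n=\sum_i D_i$, $f_n(k)=\frac1n\sum_i 1\{D_i=k\}$, $f_n^*(k)=\frac1{L_n}\sum_i k\,1\{D_i=k\}$, let $F_n^*$ be the cumulative distribution function of $f_n^*$, $\mathcal F_n^*(k)=F_n^*(k)+F_n^*(k-1)$, and $$\widetilde\rho(G)=\frac3{L_n}\sum_{i\to j\in G}\mathcal F_n^*(D_i)\mathcal F_n^*(D_j)-3 .$$ For integer-valued random variables $X,Y$ with distribution functions $F_X,F_Y$ let $\mathcal F_X(k)=F_X(k)+F_X(k-1)$ and $\rho(X,Y)=3\,\mathbb E[\mathcal F_X(X)\mathcal F_Y(Y)]-3$. Let $\eta,\varepsilon>0$, let $f,f^*$ be probability mass functions on the non-negative integers with $\sum_k k^{1+\eta}f(k)<\infty$, and let $G_n$ be random graphs on $n$ nodes such that $\mathbb P(\Omega_n)\to1$, where $$\Omega_n=\Big\{\max\Big\{\sum_{k\ge0}\Big|\sum_{t=0}^k\big(f_n(t)-f(t)\big)\Big|,\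 \sum_{k\ge0}|f_n^*(k)-f^*(k)|\Big\}\le n^{-\varepsilon}\Big\}$$ is defined by the degree sequence of $G_n$. Let $F^*$ be the cumulative distribution function of $f^*$ and, for $k,\ell\ge1$, let $$\psi(k,\ell)=1\{1-F^*(k)<F^*(\ell)\}\,1\{1-F^*(k-1)>F^*(\ell-1)\},$$ $$\mathcal E(k,\ell)=\min\big(1-F^*(k-1),F^*(\ell)\big)-\max\big(1-F^*(k),F^*(\ell-1)\big).$$ Then $h=\psi\,\mathcal E$ is a probability density on pairs of positive integers. Let $(D_*,D^*)$ have joint density $h$. For all $0<\delta<\min(\varepsilon,1/2)$ and $K>0$, with $\kappa=(\varepsilon+\delta)/2$, as $n\to\infty$, $$\mathbb P\big(\widetilde\rho(G_n)\ge\rho(D_*,D^*)-Kn^{-\delta}\big)\ge1-O\big(n^{-\varepsilon+\kappa}+\mathbb P(\Omega_n^c)\big).$$ Moreover, there are random graphs $\widehat G_n$, with the same degree sequence as $G_n$, that are outputs of the Disassortative Graph Algorithm (described below) applied to the degree sequence of $G_n$, and for every such choice of $\widehat G_n$, $$\mathbb P\big(|\widetilde\rho(\widehat G_n)-\rho(D_*,D^*)|>Kn^{-\delta}\big)=O\big(n^{-\varepsilon+\kappa}+\mathbb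 P(\Omega_n^c)\big).$$ The Disassortative Graph Algorithm: let $N_k$ be the number of nodes of degree $k$ and $z_n$ the least integer with $\sum_{t\le z_n}tN_t\ge L_n/2$. Rank the nodes by degree, ties broken arbitrarily. The list $S_n$ contains, in descending order of rank, $D_v$ stubs of each node $v$ with $D_v\ge z_n$. The list $T_n$ contains, for each $d=0,1,\dots,z_n$ in turn, $d$ copies of the list of all nodes of degree $d$ in ascending order of rank. Pair the $t$-th entries of $S_n$ and $T_n$ for $t=1,2,\dots$, stopping at the first pair whose nodes both have degree $z_n$ (or when a list ends). Pair all remaining stubs with each other, in any way (for instance by the configuration model). -/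

import Mathlib

open Filter Topology MeasureTheory

namespace Disassort

/-! ### Multigraphs and degree sequences -/

/-- An undirected multigraph on the nodes `Fin n`: a multiset of unordered pairs of nodes.
Self-loops and multiple edges are allowed. -/
abbrev Multigraph (n : ℕ) : Type := Multiset (Sym2 (Fin n))

/-- The two directed edges `i → j` and `j → i` that replace the undirected edge `i - j`
(a self-loop `i - i` is replaced by two copies of `i → i`). -/
def biEdges {n : ℕ} (e : Sym2 (Fin n)) : Multiset (Fin n × Fin n) :=
  Sym2.lift ⟨fun i j => {(i, j), (j, i)}, fun i j => Multiset.pair_comm (i, j) (j, i)⟩ e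

/-- The multiset of directed edges of the bi-directed version of `G`. -/
def dirEdges {n : ℕ} (G : Multigraph n) : Multiset (Fin n × Fin n) := G.bind biEdges

/-- The degree of a node (a self-loop counts twice). -/
def degree {n : ℕ} (G : Multigraph n) (i : Fin n) : ℕ := ((dirEdges G).map Prod.fst).count i

/-- `L_n`, the sum of the degrees. -/
def totalDegree {n : ℕ} (D : Fin n → ℕ) : ℕ := ∑ i, D i

/-- `N_k`, the number of nodes of degree `k`. -/
def numNodes {n : ℕ} (D : Fin n → ℕ) (k : ℕ) : ℕ := (Finset.univ.filter fun i => D i = k).card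

/-- The empirical degree distribution `f_n`. -/
noncomputable def empDensity {n : ℕ} (D : Fin n → ℕ) (k : ℕ) : ℝ :=
  (1 / (n : ℝ)) * ∑ i, if D i = k then (1 : ℝ) else 0

/-- The empirical size-biased degree distribution `f_n^*`. -/
noncomputable def sizeBiasedDensity {n : ℕ} (D : Fin n → ℕ) (k : ℕ) : ℝ :=
  (1 / (totalDegree D : ℝ)) * ∑ i, if D i = k then (k : ℝ) else 0

/-- The cumulative distribution function `k ↦ ∑_{t ≤ k} p t`, at all integers `k`, of a density on
the non-negative integers. -/
noncomputable def cumul (p : ℕ → ℝ) (k : ℤ) : ℝ := ∑ t ∈ Finset.range (k + 1).toNat, p t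

/-- The real-valued density of a probability mass function. -/
noncomputable def density (f : PMF ℕ) (k : ℕ) : ℝ := (f k).toReal

/-- `𝓕(k) = F(k) + F(k - 1)`. -/
def midRank (F : ℤ → ℝ) (k : ℤ) : ℝ := F k + F (k - 1)

/-! ### The convergence assumption -/

/-- The degree sequence `D` is within distance `n ^ (-ε)` of `(f, f^*)`: in the
Kantorovich-Rubinstein distance for `f_n` and in the `1`-norm for `f_n^*`. -/
def Close {n : ℕ} (ε : ℝ) (f fs : PMF ℕ) (D : Fin n → ℕ) : Prop :=
  max (∑' k : ℕ, ENNReal.ofReal |∑ t ∈ Finset.range (k + 1), (empDensity D t - density f t)|)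
      (∑' k : ℕ, ENNReal.ofReal |sizeBiasedDensity D k - density fs k|)
    ≤ ENNReal.ofReal ((n : ℝ) ^ (-ε))

/-- The event `Ω_n` for a random graph. -/
def closeEvent {n : ℕ} {Ω : Type*} (ε : ℝ) (f fs : PMF ℕ) (G : Ω → Multigraph n) : Set Ω :=
  {ω | Close ε f fs (degree (G ω))}

/-- The random graphs `G n`, `n = 0, 1, 2, …`, with `G n` defined on the probability space
`(Ω n, P n)`, belong to the class `𝒢_{η, ε}(f, f^*)`. -/
structure InClass {Ω : ℕ → Type*} [∀ n, MeasurableSpace (Ω n)] (P : ∀ n, Measure (Ω n))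
    (η ε : ℝ) (f fs : PMF ℕ) (G : ∀ n, Ω n → Multigraph n) : Prop where
  eta_pos : 0 < η
  eps_pos : 0 < ε
  moment : ∑' k : ℕ, (k : ENNReal) ^ (1 + η) * f k < ⊤
  measurable_graph : ∀ n (g : Multigraph n), MeasurableSet {ω | G n ω = g}
  tendsto_one : Tendsto (fun n => (P n) (closeEvent ε f fs (G n))) atTop (𝓝 1)

/-! ### Spearman's rho -/

/-- The cumulative distribution function of an integer valued random variable. -/
noncomputable def cdfOf {Ω : Type*} [MeasurableSpace Ω] (Q : Measure Ω) (X : Ω → ℤ) (k : ℤ) : ℝ :=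
  Q.real {ω | X ω ≤ k}

/-- Spearman's rho of two integer valued random variables:
`ρ(X, Y) = 3 E[𝓕_X(X) 𝓕_Y(Y)] - 3`. -/
noncomputable def spearmanRho {Ω : Type*} [MeasurableSpace Ω] (Q : Measure Ω) (X Y : Ω → ℤ) : ℝ :=
  3 * ∫ ω, midRank (cdfOf Q X) (X ω) * midRank (cdfOf Q Y) (Y ω) ∂Q - 3

/-- Spearman's rho `ρ̃(G)` of a multigraph:
`(3 / L_n) ∑_{i → j} 𝓕_n^*(D_i) 𝓕_n^*(D_j) - 3`. -/
noncomputable def graphRho {n : ℕ} (G : Multigraph n) : ℝ :=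
  3 / (totalDegree (degree G) : ℝ) *
    ((dirEdges G).map fun a =>
      midRank (cumul (sizeBiasedDensity (degree G))) (degree G a.1) *
        midRank (cumul (sizeBiasedDensity (degree G))) (degree G a.2)).sum - 3

/-! ### The joint density `h` -/

open Classical in
/-- `ψ(k, ℓ)`, for the cumulative distribution function `F`. -/
noncomputable def psi (F : ℤ → ℝ) (k l : ℤ) : ℝ :=
  (if 1 - F k < F l then 1 else 0) * (if 1 - F (k - 1) > F (l - 1) then 1 else 0)

/-- `ℰ(k, ℓ)`, for the cumulative distribution function `F`. -/
noncomputable def overlap (F : ℤ → ℝ) (k l : ℤ) : ℝ :=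
  min (1 - F (k - 1)) (F l) - max (1 - F k) (F (l - 1))

/-- `h(k, ℓ) = ψ(k, ℓ) ℰ(k, ℓ)` for `k, ℓ ≥ 1`, and zero elsewhere, where the cumulative
distribution function `F^*` is that of `fs`. -/
noncomputable def jointDensity (fs : PMF ℕ) (k l : ℤ) : ℝ :=
  if 1 ≤ k ∧ 1 ≤ l then psi (cumul (density fs)) k l * overlap (cumul (density fs)) k l else 0

/-! ### The Disassortative Graph Algorithm -/

/-- `z_n`: the least integer `z` with `∑_{t ≤ z} t N_t ≥ L_n / 2`. -/
noncomputable def medianDegree {n : ℕ} (D : Fin n → ℕ) : ℕ :=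
  sInf {z : ℕ | (totalDegree D : ℝ) / 2 ≤ ∑ t ∈ Finset.range (z + 1), (t : ℝ) * numNodes D t}

/-- The list `S_n`: in descending order of rank, `D_v` stubs for each node `v` of degree at
least `z`. Here `φ` maps ranks to nodes. -/
def leftStubs {n : ℕ} (D : Fin n → ℕ) (φ : Equiv.Perm (Fin n)) (z : ℕ) : List (Fin n) :=
  (((List.finRange n).reverse.map φ).filter fun v => z ≤ D v).flatMap
    fun v => List.replicate (D v) v

/-- The list `T_n`: in ascending order of the degree `d ≤ z`, `d` copies of the list of all nodes
of degree `d` in ascending order of rank. -/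
def rightStubs {n : ℕ} (D : Fin n → ℕ) (φ : Equiv.Perm (Fin n)) (z : ℕ) : List (Fin n) :=
  (List.range (z + 1)).flatMap fun d =>
    (List.replicate d (((List.finRange n).map φ).filter fun v => D v = d)).flatten

/-- The edges of `G_n^*`: `S_n` and `T_n` are paired from the top until the first pair of stubs
that both belong to nodes of degree `z`. -/
def pairedEdges {n : ℕ} (D : Fin n → ℕ) (φ : Equiv.Perm (Fin n)) (z : ℕ) : Multigraph n :=
  (((List.zip (leftStubs D φ z) (rightStubs D φ z)).takeWhile
      fun a => !decide (D a.1 = z ∧ D a.2 = z)).map fun a => s(a.1, a.2) : List (Sym2 (Fin n)))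

/-- `G` is a possible output of the Disassortative Graph Algorithm with the degree sequence `D` as
input: for a ranking `φ` of the nodes by degree (ties broken arbitrarily), `G` consists of the
edges of `G_n^*` and of the edges of a multigraph `R` that pairs all the remaining stubs (every
such `R` is a possible outcome of the configuration model). -/
def IsDGAOutput {n : ℕ} (D : Fin n → ℕ) (G : Multigraph n) : Prop :=
  ∃ φ : Equiv.Perm (Fin n), Monotone (D ∘ φ) ∧
    ∃ R : Multigraph n,
      (∀ i, degree (pairedEdges D φ (medianDegree D)) i + degree R i = D i) ∧
        G = pairedEdges D φ (medianDegree D) + R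

end Disassort

/-! Everything reduces to one functional of a density `p` on the positive integers. The mid-rank
function telescopes with increments `w k = p k + p (k + 1)`, so for any coupling `(X, Y)` of `p`
with itself `E[𝓕(X) 𝓕(Y)]` is the sum over `(k, l)` of `w k * w l * P(X > k, Y > l)` (Hoeffding's
identity). Inclusion-exclusion gives the Fréchet bound `P(X > k, Y > l) ≥ max 0 (1 - F k - F l)`,
attained by the countermonotonic coupling; inserting it yields `counterValue p`.

A uniformly chosen directed edge of a graph couples the size-biased distribution with itself, since
reversing all edges changes nothing. Hence `counterValue_le_graphRho` holds for each graph with an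
edge, with equality when no two edges are strictly concordant in degree
(`OppositelyOrdered.graphRho_eq`). The algorithm pairs a descending list with an ascending one, and
the stubs left over all have the median degree, so its outputs are such graphs
(`IsDGAOutput.oppositelyOrdered`).

The density `h` is the rectangle increment of `max 0 (F k + F l - 1)`, the law of the
countermonotonic coupling of `f^*` (`spearmanRho_eq_of_jointDensity`). Finally `counterValue` is
Lipschitz for the `1`-norm (`IsPosDensity.abs_counterValue_sub_le`), so on `Ω_n` the two values of
rho differ by at most `48 n ^ (-ε)`, eventually below `K n ^ (-δ)`. The exceptional events thus lie
in the complement of `Ω_n`, up to null sets. -/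

namespace Disassort

/-! ### Densities on the positive integers -/

/-- `p` is the density of a probability measure on the positive integers. -/
structure IsPosDensity (p : ℕ → ℝ) : Prop where
  nonneg : ∀ k, 0 ≤ p k
  zero : p 0 = 0
  hasSum : HasSum p 1

theorem cumul_natCast (p : ℕ → ℝ) (k : ℕ) : cumul p k = ∑ t ∈ Finset.range (k + 1), p t := by
  unfold cumul
  congr 2

theorem cumul_natCast_succ (p : ℕ → ℝ) (k : ℕ) :
    cumul p ((k : ℤ) + 1) = cumul p k + p (k + 1) := by
  have h := cumul_natCast p (k + 1)
  push_cast at h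
  rw [h, Finset.sum_range_succ, cumul_natCast]

theorem cumul_of_neg (p : ℕ → ℝ) {k : ℤ} (hk : k < 0) : cumul p k = 0 := by
  unfold cumul
  rw [Int.toNat_of_nonpos (by omega)]
  simp

namespace IsPosDensity

variable {p : ℕ → ℝ}

theorem cumul_zero (hp : IsPosDensity p) : cumul p 0 = 0 := by
  have := cumul_natCast p 0
  simpa [hp.zero] using this

theorem cumul_nonneg (hp : IsPosDensity p) (k : ℤ) : 0 ≤ cumul p k :=
  Finset.sum_nonneg fun _ _ => hp.nonneg _

theorem cumul_le_one (hp : IsPosDensity p) (k : ℤ) : cumul p k ≤ 1 :=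
  sum_le_hasSum _ (fun _ _ => hp.nonneg _) hp.hasSum

theorem cumul_mono (hp : IsPosDensity p) : Monotone (cumul p) := fun _ _ h =>
  Finset.sum_le_sum_of_subset_of_nonneg (Finset.range_mono (by omega)) fun _ _ _ => hp.nonneg _

theorem tendsto_cumul (hp : IsPosDensity p) :
    Tendsto (fun k : ℕ => cumul p k) atTop (𝓝 1) := by
  simp_rw [cumul_natCast]
  exact (tendsto_add_atTop_iff_nat 1).2 hp.hasSum.tendsto_sum_nat

end IsPosDensity

/-- The increments `𝓕(k + 1) - 𝓕(k)` of the mid-rank function with density `p`. -/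
def midIncr (p : ℕ → ℝ) (k : ℕ) : ℝ := p k + p (k + 1)

/-- Telescoping: `F (m + 1) - F (m - 1) = p m + p (m + 1)`, and `p 0 = 0` makes the starting value
vanish. -/
theorem midRank_cumul (p : ℕ → ℝ) (h0 : p 0 = 0) (m : ℕ) :
    midRank (cumul p) m = ∑ k ∈ Finset.range m, midIncr p k := by
  induction m with
  | zero =>
    have h1 := cumul_natCast p 0
    have h2 : cumul p (0 - 1) = 0 := cumul_of_neg p (by norm_num)
    simp only [midRank, Nat.cast_zero, Finset.range_zero, Finset.sum_empty, h2]
    simpa [h0] using h1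
  | succ m ih =>
    rw [Finset.sum_range_succ, ← ih]
    unfold midRank midIncr
    push_cast
    rw [cumul_natCast_succ, add_sub_cancel_right]
    rcases m with _ | m
    · have := cumul_natCast p 0
      have h1 : cumul p (-1) = 0 := cumul_of_neg p (by norm_num)
      simp_all
    · push_cast
      rw [add_sub_cancel_right, cumul_natCast_succ]
      ring

/-- The joint survival function `P(X > k, Y > l)` of the countermonotonic coupling of the
density `p` with itself. -/
noncomputable def counterSurvival (p : ℕ → ℝ) (x : ℕ × ℕ) : ℝ :=
  max 0 (1 - cumul p x.1 - cumul p x.2)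

/-- `E[𝓕(X) 𝓕(Y)]` for the countermonotonic coupling of the density `p` with itself. -/
noncomputable def counterValue (p : ℕ → ℝ) : ℝ :=
  ∑' x : ℕ × ℕ, midIncr p x.1 * midIncr p x.2 * counterSurvival p x

namespace IsPosDensity

variable {p q : ℕ → ℝ}

theorem midIncr_nonneg (hp : IsPosDensity p) (k : ℕ) : 0 ≤ midIncr p k :=
  add_nonneg (hp.nonneg _) (hp.nonneg _)

theorem hasSum_succ (hp : IsPosDensity p) : HasSum (fun k => p (k + 1)) 1 := by
  rw [hasSum_nat_add_iff 1]
  simpa [hp.zero] using hp.hasSum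

theorem hasSum_midIncr (hp : IsPosDensity p) : HasSum (midIncr p) 2 := by
  have := hp.hasSum.add hp.hasSum_succ
  norm_num at this
  exact this

theorem counterSurvival_nonneg (p : ℕ → ℝ) (x : ℕ × ℕ) : 0 ≤ counterSurvival p x :=
  le_max_left _ _

theorem counterSurvival_le_one (hp : IsPosDensity p) (x : ℕ × ℕ) : counterSurvival p x ≤ 1 :=
  max_le zero_le_one (by linarith [hp.cumul_nonneg x.1, hp.cumul_nonneg x.2])

theorem summable_midIncr_mul (hp : IsPosDensity p) (hq : IsPosDensity q) :
    Summable fun x : ℕ × ℕ => midIncr p x.1 * midIncr q x.2 :=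
  hp.hasSum_midIncr.summable.mul_of_nonneg hq.hasSum_midIncr.summable
    hp.midIncr_nonneg hq.midIncr_nonneg

theorem summable_counterValue (hp : IsPosDensity p) :
    Summable fun x : ℕ × ℕ => midIncr p x.1 * midIncr p x.2 * counterSurvival p x :=
  Summable.of_nonneg_of_le
    (fun x => mul_nonneg (mul_nonneg (hp.midIncr_nonneg _) (hp.midIncr_nonneg _))
      (counterSurvival_nonneg p x))
    (fun x => mul_le_of_le_one_right (mul_nonneg (hp.midIncr_nonneg _) (hp.midIncr_nonneg _))
      (hp.counterSurvival_le_one x))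
    (hp.summable_midIncr_mul hp)

theorem summable_abs_sub (hp : IsPosDensity p) (hq : IsPosDensity q) :
    Summable fun k => |p k - q k| :=
  (hp.hasSum.summable.sub hq.hasSum.summable).abs

theorem abs_cumul_sub_le (hp : IsPosDensity p) (hq : IsPosDensity q) (k : ℤ) :
    |cumul p k - cumul q k| ≤ ∑' t, |p t - q t| := by
  unfold cumul
  rw [← Finset.sum_sub_distrib]
  exact (Finset.abs_sum_le_sum_abs _ _).trans
    ((hp.summable_abs_sub hq).sum_le_tsum _ fun _ _ => abs_nonneg _)

/-- The positive part is 1-Lipschitz, and each of the two distribution functions moves by at most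
the `1`-norm distance. -/
theorem abs_counterSurvival_sub_le (hp : IsPosDensity p) (hq : IsPosDensity q) (x : ℕ × ℕ) :
    |counterSurvival p x - counterSurvival q x| ≤ 2 * ∑' t, |p t - q t| := by
  unfold counterSurvival
  refine (abs_max_sub_max_le_max _ _ _ _).trans ?_
  have h1 := abs_le.1 (hp.abs_cumul_sub_le hq x.1)
  have h2 := abs_le.1 (hp.abs_cumul_sub_le hq x.2)
  refine max_le ?_ ?_
  · simpa using tsum_nonneg fun _ => abs_nonneg _
  · rw [abs_le]
    constructor <;> linarith [h1.1, h1.2, h2.1, h2.2]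

theorem summable_abs_midIncr_sub (hp : IsPosDensity p) (hq : IsPosDensity q) :
    Summable fun k => |midIncr p k - midIncr q k| :=
  (hp.hasSum_midIncr.summable.sub hq.hasSum_midIncr.summable).abs

theorem tsum_abs_midIncr_sub_le (hp : IsPosDensity p) (hq : IsPosDensity q) :
    ∑' k, |midIncr p k - midIncr q k| ≤ 2 * ∑' t, |p t - q t| := by
  have hs := hp.summable_abs_sub hq
  have hs' : Summable fun k => |p (k + 1) - q (k + 1)| := (summable_nat_add_iff 1).2 hs
  have h1 : ∑' k, |midIncr p k - midIncr q k| ≤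
      ∑' k, (|p k - q k| + |p (k + 1) - q (k + 1)|) := by
    refine (hp.summable_abs_midIncr_sub hq).tsum_le_tsum (fun k => ?_) (hs.add hs')
    have : midIncr p k - midIncr q k = (p k - q k) + (p (k + 1) - q (k + 1)) := by
      unfold midIncr; ring
    rw [this]
    exact abs_add_le _ _
  have h2 : ∑' k, |p k - q k| = |p 0 - q 0| + ∑' k, |p (k + 1) - q (k + 1)| :=
    hs.tsum_eq_zero_add
  rw [hs.tsum_add hs'] at h1
  linarith [abs_nonneg (p 0 - q 0)]

/-- The value of the countermonotonic coupling is Lipschitz in the density. -/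
theorem abs_counterValue_sub_le (hp : IsPosDensity p) (hq : IsPosDensity q) :
    |counterValue p - counterValue q| ≤ 16 * ∑' t, |p t - q t| := by
  set d := ∑' t, |p t - q t| with hd
  have hd0 : 0 ≤ d := tsum_nonneg fun _ => abs_nonneg _
  have hw := hp.summable_abs_midIncr_sub hq
  have hwd := hp.tsum_abs_midIncr_sub_le hq
  have hp2 := hp.hasSum_midIncr
  have hq2 := hq.hasSum_midIncr
  have s1 : Summable fun x : ℕ × ℕ => |midIncr p x.1 - midIncr q x.1| * midIncr p x.2 :=
    hw.mul_of_nonneg hp2.summable (fun _ => abs_nonneg _) hp.midIncr_nonneg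
  have s2 : Summable fun x : ℕ × ℕ => midIncr q x.1 * |midIncr p x.2 - midIncr q x.2| :=
    hq2.summable.mul_of_nonneg hw hq.midIncr_nonneg (fun _ => abs_nonneg _)
  have s3 : Summable fun x : ℕ × ℕ => midIncr q x.1 * midIncr q x.2 :=
    hq.summable_midIncr_mul hq
  have t1 := hw.tsum_mul_tsum hp2.summable s1
  have t2 := hq2.summable.tsum_mul_tsum hw s2
  have t3 := hq2.summable.tsum_mul_tsum hq2.summable s3
  rw [hp2.tsum_eq] at t1
  rw [hq2.tsum_eq] at t2 t3
  unfold counterValue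
  rw [← hp.summable_counterValue.tsum_sub hq.summable_counterValue]
  -- The three factors are exchanged one at a time. As the weights sum to 2 and their differences to
  -- at most `2 * d`, the total is at most `2d * 2 + 2 * 2d + 2 * 2 * 2d = 16d`.
  have hbound : ∀ x : ℕ × ℕ,
      |midIncr p x.1 * midIncr p x.2 * counterSurvival p x -
        midIncr q x.1 * midIncr q x.2 * counterSurvival q x| ≤
      |midIncr p x.1 - midIncr q x.1| * midIncr p x.2 +
        midIncr q x.1 * |midIncr p x.2 - midIncr q x.2| +
        midIncr q x.1 * midIncr q x.2 * (2 * d) := by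
    intro x
    have e : midIncr p x.1 * midIncr p x.2 * counterSurvival p x -
        midIncr q x.1 * midIncr q x.2 * counterSurvival q x =
        (midIncr p x.1 - midIncr q x.1) * midIncr p x.2 * counterSurvival p x +
        midIncr q x.1 * (midIncr p x.2 - midIncr q x.2) * counterSurvival p x +
        midIncr q x.1 * midIncr q x.2 * (counterSurvival p x - counterSurvival q x) := by ring
    rw [e]
    have hc0 := counterSurvival_nonneg p x
    have hc1 := hp.counterSurvival_le_one x
    have a1 := hp.midIncr_nonneg x.2
    have a2 := hq.midIncr_nonneg x.1
    have a3 := hq.midIncr_nonneg x.2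
    refine (abs_add_three _ _ _).trans (add_le_add (add_le_add ?_ ?_) ?_)
    · rw [abs_mul, abs_mul, abs_of_nonneg a1, abs_of_nonneg hc0]
      exact mul_le_of_le_one_right (by positivity) hc1
    · rw [abs_mul, abs_mul, abs_of_nonneg a2, abs_of_nonneg hc0]
      exact mul_le_of_le_one_right (by positivity) hc1
    · rw [abs_mul, abs_mul, abs_of_nonneg a2, abs_of_nonneg a3]
      exact mul_le_mul_of_nonneg_left (hp.abs_counterSurvival_sub_le hq x) (by positivity)
  have hsum := (s1.add s2).add (s3.mul_right (2 * d))
  have := tsum_of_norm_bounded hsum.hasSum (fun x => (Real.norm_eq_abs _).trans_le (hbound x))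
  rw [Real.norm_eq_abs, (s1.add s2).tsum_add (s3.mul_right (2 * d)), s1.tsum_add s2,
    tsum_mul_right, ← t1, ← t2, ← t3] at this
  linarith

end IsPosDensity

end Disassort

namespace Disassort

/-! ### Spearman's rho of a multigraph -/

variable {n : ℕ}

theorem biEdges_mk (i j : Fin n) : biEdges s(i, j) = {(i, j), (j, i)} := rfl

theorem dirEdges_add (G H : Multigraph n) : dirEdges (G + H) = dirEdges G + dirEdges H :=
  Multiset.add_bind _ _ _

theorem degree_add (G H : Multigraph n) (i : Fin n) :
    degree (G + H) i = degree G i + degree H i := by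
  simp [degree, dirEdges_add]

theorem map_swap_dirEdges (G : Multigraph n) : (dirEdges G).map Prod.swap = dirEdges G := by
  unfold dirEdges
  rw [Multiset.map_bind]
  refine Multiset.bind_congr fun e _ => ?_
  induction e with
  | h i j =>
    rw [biEdges_mk]
    simpa using Multiset.pair_comm (j, i) (i, j)

theorem swap_mem_dirEdges {G : Multigraph n} {a b : Fin n} (h : (a, b) ∈ dirEdges G) :
    (b, a) ∈ dirEdges G := by
  rw [← map_swap_dirEdges]
  exact Multiset.mem_map.2 ⟨(a, b), h, rfl⟩

/-- Both ends of a uniform directed edge therefore have the same, size-biased, law. -/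
theorem map_snd_dirEdges (G : Multigraph n) :
    (dirEdges G).map Prod.snd = (dirEdges G).map Prod.fst := by
  conv_rhs => rw [← map_swap_dirEdges, Multiset.map_map]
  rfl

theorem countP_eq_sum_count (m : Multiset (Fin n)) (q : Fin n → Prop) [DecidablePred q] :
    m.countP q = ∑ i, if q i then m.count i else 0 := by
  rw [Multiset.countP_eq_card_filter,
    ← Multiset.sum_count_eq_card (s := Finset.univ) (fun _ _ => Finset.mem_univ _)]
  simp_rw [Multiset.count_filter]

theorem countP_fst_dirEdges (G : Multigraph n) (q : Fin n → Prop) [DecidablePred q] :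
    (dirEdges G).countP (fun a => q a.1) = ∑ i, if q i then degree G i else 0 := by
  unfold degree
  rw [← countP_eq_sum_count, Multiset.countP_map, Multiset.countP_eq_card_filter]

theorem countP_snd_dirEdges (G : Multigraph n) (q : Fin n → Prop) [DecidablePred q] :
    (dirEdges G).countP (fun a => q a.2) = ∑ i, if q i then degree G i else 0 := by
  unfold degree
  rw [← countP_eq_sum_count, ← map_snd_dirEdges, Multiset.countP_map,
    Multiset.countP_eq_card_filter]

theorem card_dirEdges (G : Multigraph n) : (dirEdges G).card = totalDegree (degree G) := by
  have := countP_fst_dirEdges G (fun _ => True)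
  simpa [totalDegree, Multiset.countP_eq_card_filter] using this

theorem degree_le_totalDegree (D : Fin n → ℕ) (i : Fin n) : D i ≤ totalDegree D :=
  Finset.single_le_sum (fun _ _ => Nat.zero_le _) (Finset.mem_univ i)

theorem sizeBiasedDensity_zero (D : Fin n → ℕ) : sizeBiasedDensity D 0 = 0 := by
  simp [sizeBiasedDensity]

theorem sizeBiasedDensity_eq_zero (D : Fin n → ℕ) {k : ℕ} (hk : totalDegree D < k) :
    sizeBiasedDensity D k = 0 := by
  unfold sizeBiasedDensity
  rw [Finset.sum_eq_zero, mul_zero]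
  intro i _
  exact if_neg (by have := degree_le_totalDegree D i; omega)

theorem totalDegree_mul_cumul {D : Fin n → ℕ} (hL : totalDegree D ≠ 0) (k : ℕ) :
    (totalDegree D : ℝ) * cumul (sizeBiasedDensity D) k =
      ((∑ i, if D i ≤ k then D i else 0 : ℕ) : ℝ) := by
  have hL' : (totalDegree D : ℝ) ≠ 0 := by exact_mod_cast hL
  rw [cumul_natCast]
  unfold sizeBiasedDensity
  rw [← Finset.mul_sum, ← mul_assoc, mul_one_div_cancel hL', one_mul, Finset.sum_comm]
  push_cast
  refine Finset.sum_congr rfl fun i _ => ?_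
  rw [Finset.sum_ite_eq]
  simp [Finset.mem_range]

theorem isPosDensity_sizeBiasedDensity {D : Fin n → ℕ} (hL : totalDegree D ≠ 0) :
    IsPosDensity (sizeBiasedDensity D) where
  nonneg k := by
    unfold sizeBiasedDensity
    refine mul_nonneg (by positivity) (Finset.sum_nonneg fun i _ => ?_)
    split_ifs <;> positivity
  zero := sizeBiasedDensity_zero D
  hasSum := by
    have hL' : (totalDegree D : ℝ) ≠ 0 := by exact_mod_cast hL
    have h1 := totalDegree_mul_cumul hL (totalDegree D)
    simp_rw [if_pos (degree_le_totalDegree D _)] at h1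
    have h2 : cumul (sizeBiasedDensity D) (totalDegree D) = 1 := by
      apply mul_left_cancel₀ hL'
      rw [h1, mul_one, totalDegree]
    rw [cumul_natCast] at h2
    rw [← h2]
    refine hasSum_sum_of_ne_finset_zero fun k hk => sizeBiasedDensity_eq_zero D ?_
    simp only [Finset.mem_range] at hk
    omega

theorem sum_map_sum_eq {α ι : Type*} (m : Multiset α) (s : Finset ι) (f : ι → α → ℝ) :
    (m.map fun a => ∑ i ∈ s, f i a).sum = ∑ i ∈ s, (m.map (f i)).sum := by
  induction m using Multiset.induction with
  | empty => simp
  | cons a m ih => simp [ih, Finset.sum_add_distrib]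

theorem sum_map_const_mul_ite {α : Type*} (m : Multiset α) (q : α → Prop) [DecidablePred q]
    (c : ℝ) : (m.map fun a => c * if q a then 1 else 0).sum = c * m.countP q := by
  induction m using Multiset.induction with
  | empty => simp
  | cons a m ih =>
    rw [Multiset.map_cons, Multiset.sum_cons, ih, Multiset.countP_cons]
    split_ifs <;> push_cast <;> ring

/-- A range independent of `m` allows the sum over edges and the sums over thresholds to be
exchanged. -/
theorem midRank_eq_sum_range {p : ℕ → ℝ} (h0 : p 0 = 0) {m M : ℕ} (h : m ≤ M) :
    midRank (cumul p) m = ∑ k ∈ Finset.range M, midIncr p k * if k < m then 1 else 0 := by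
  rw [midRank_cumul p h0]
  simp_rw [mul_ite, mul_one, mul_zero]
  rw [← Finset.sum_filter]
  refine Finset.sum_congr ?_ fun _ _ => rfl
  ext k
  simp only [Finset.mem_range, Finset.mem_filter]
  omega

/-- The number of directed edges whose end nodes have degrees above `k` and `l`. -/
def numAbove (G : Multigraph n) (x : ℕ × ℕ) : ℕ :=
  (dirEdges G).countP fun a => x.1 < degree G a.1 ∧ x.2 < degree G a.2

/-- Hoeffding's identity for a uniform directed edge; no degree exceeds `L_n`, so finitely many
thresholds suffice. -/
theorem graphRho_eq_sum (G : Multigraph n) :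
    graphRho G = 3 * ∑ x ∈ Finset.range (totalDegree (degree G) + 1) ×ˢ
        Finset.range (totalDegree (degree G) + 1),
      midIncr (sizeBiasedDensity (degree G)) x.1 * midIncr (sizeBiasedDensity (degree G)) x.2 *
        (numAbove G x / totalDegree (degree G)) - 3 := by
  set D := degree G with hD
  set M := totalDegree D + 1 with hM
  have hDM : ∀ i, D i ≤ M := fun i => (degree_le_totalDegree D i).trans (Nat.le_succ _)
  unfold graphRho
  have key : ((dirEdges G).map fun a => midRank (cumul (sizeBiasedDensity D)) (D a.1) *
        midRank (cumul (sizeBiasedDensity D)) (D a.2)).sum =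
      ∑ x ∈ Finset.range M ×ˢ Finset.range M,
        midIncr (sizeBiasedDensity D) x.1 * midIncr (sizeBiasedDensity D) x.2 *
          numAbove G x := by
    have h1 : ∀ a : Fin n × Fin n, midRank (cumul (sizeBiasedDensity D)) (D a.1) *
        midRank (cumul (sizeBiasedDensity D)) (D a.2) =
        ∑ x ∈ Finset.range M ×ˢ Finset.range M,
          midIncr (sizeBiasedDensity D) x.1 * midIncr (sizeBiasedDensity D) x.2 *
            if x.1 < D a.1 ∧ x.2 < D a.2 then 1 else 0 := by
      intro a
      rw [midRank_eq_sum_range (sizeBiasedDensity_zero D) (hDM a.1),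
        midRank_eq_sum_range (sizeBiasedDensity_zero D) (hDM a.2), Finset.sum_mul_sum,
        ← Finset.sum_product']
      refine Finset.sum_congr rfl fun x _ => ?_
      by_cases h : x.1 < D a.1 <;> by_cases h' : x.2 < D a.2 <;> simp [h, h']
    simp_rw [h1]
    rw [sum_map_sum_eq]
    refine Finset.sum_congr rfl fun x _ => ?_
    rw [sum_map_const_mul_ite]
    rfl
  rw [← hD, key]
  congr 1
  rw [div_mul_eq_mul_div, mul_div_assoc, Finset.sum_div]
  simp_rw [mul_div_assoc]

theorem counterValue_sizeBiasedDensity (D : Fin n → ℕ) :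
    counterValue (sizeBiasedDensity D) =
      ∑ x ∈ Finset.range (totalDegree D + 1) ×ˢ Finset.range (totalDegree D + 1),
        midIncr (sizeBiasedDensity D) x.1 * midIncr (sizeBiasedDensity D) x.2 *
          counterSurvival (sizeBiasedDensity D) x := by
  have hz : ∀ k, totalDegree D + 1 ≤ k → midIncr (sizeBiasedDensity D) k = 0 := fun k hk => by
    unfold midIncr
    rw [sizeBiasedDensity_eq_zero D (by omega), sizeBiasedDensity_eq_zero D (by omega), add_zero]
  refine tsum_eq_sum fun x hx => ?_
  simp only [Finset.mem_product, Finset.mem_range, not_and_or, not_lt] at hx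
  rcases hx with hx | hx <;> simp [hz _ hx]

/-- Inclusion-exclusion, arranged without subtraction in `ℕ`. -/
theorem countP_and_add_countP_not {α : Type*} (m : Multiset α) (q r : α → Prop)
    [DecidablePred q] [DecidablePred r] :
    m.countP (fun a => q a ∧ r a) + m.countP (fun a => ¬ q a) + m.countP (fun a => ¬ r a) =
      m.card + m.countP (fun a => ¬ q a ∧ ¬ r a) := by
  induction m using Multiset.induction with
  | empty => simp
  | cons a m ih =>
    simp only [Multiset.countP_cons, Multiset.card_cons]
    by_cases h : q a <;> by_cases h' : r a <;> simp [h, h'] <;> omega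

theorem numAbove_div_eq (G : Multigraph n) (hL : totalDegree (degree G) ≠ 0) (x : ℕ × ℕ) :
    (numAbove G x : ℝ) / totalDegree (degree G) =
      1 - cumul (sizeBiasedDensity (degree G)) x.1 - cumul (sizeBiasedDensity (degree G)) x.2 +
        ((dirEdges G).countP fun a => ¬ x.1 < degree G a.1 ∧ ¬ x.2 < degree G a.2 : ℕ) /
          totalDegree (degree G) := by
  have hL' : (totalDegree (degree G) : ℝ) ≠ 0 := by exact_mod_cast hL
  have h := countP_and_add_countP_not (dirEdges G) (fun a => x.1 < degree G a.1)
    (fun a => x.2 < degree G a.2)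
  rw [countP_fst_dirEdges G fun i => ¬ x.1 < degree G i,
    countP_snd_dirEdges G fun i => ¬ x.2 < degree G i, card_dirEdges] at h
  simp_rw [not_lt] at h ⊢
  have h1 := totalDegree_mul_cumul hL x.1
  have h2 := totalDegree_mul_cumul hL x.2
  have h' := congrArg (Nat.cast : ℕ → ℝ) h
  simp only [Nat.cast_add] at h'
  rw [← h1, ← h2] at h'
  unfold numAbove
  field_simp
  linarith

theorem counterSurvival_le_numAbove_div (G : Multigraph n) (hL : totalDegree (degree G) ≠ 0)
    (x : ℕ × ℕ) : counterSurvival (sizeBiasedDensity (degree G)) x ≤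
      numAbove G x / totalDegree (degree G) := by
  refine max_le (by positivity) ?_
  rw [numAbove_div_eq G hL]
  exact le_add_of_nonneg_right (by positivity)

/-- The degrees at the two ends of the directed edges of `G` are oppositely ordered. -/
def OppositelyOrdered (G : Multigraph n) : Prop :=
  ∀ a ∈ dirEdges G, ∀ b ∈ dirEdges G,
    degree G b.1 < degree G a.1 → degree G a.2 ≤ degree G b.2

/-- If some edge has both degrees above the thresholds, opposite ordering forbids an edge with both
degrees at or below them, so the excess over the Fréchet bound is zero. Otherwise the count itself
is zero. -/
theorem OppositelyOrdered.counterSurvival_eq {G : Multigraph n} (hG : OppositelyOrdered G)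
    (hL : totalDegree (degree G) ≠ 0) (x : ℕ × ℕ) :
    counterSurvival (sizeBiasedDensity (degree G)) x =
      numAbove G x / totalDegree (degree G) := by
  refine le_antisymm (counterSurvival_le_numAbove_div G hL x) ?_
  by_cases h : numAbove G x = 0
  · rw [h]
    simpa using IsPosDensity.counterSurvival_nonneg _ x
  · obtain ⟨a, ha, ha1, ha2⟩ := Multiset.countP_pos.1 (Nat.pos_of_ne_zero h)
    have h0 : ((dirEdges G).countP fun a => ¬ x.1 < degree G a.1 ∧ ¬ x.2 < degree G a.2) = 0 := by
      refine Multiset.countP_eq_zero.2 fun b hb hb' => ?_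
      have := hG a ha b hb (by omega)
      omega
    rw [numAbove_div_eq G hL, h0]
    simp [counterSurvival]

theorem counterValue_le_graphRho (G : Multigraph n) (hL : totalDegree (degree G) ≠ 0) :
    3 * counterValue (sizeBiasedDensity (degree G)) - 3 ≤ graphRho G := by
  have hp := isPosDensity_sizeBiasedDensity hL
  rw [graphRho_eq_sum, counterValue_sizeBiasedDensity]
  gcongr with x
  · exact mul_nonneg (hp.midIncr_nonneg _) (hp.midIncr_nonneg _)
  · exact counterSurvival_le_numAbove_div G hL x

theorem OppositelyOrdered.graphRho_eq {G : Multigraph n} (hG : OppositelyOrdered G)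
    (hL : totalDegree (degree G) ≠ 0) :
    graphRho G = 3 * counterValue (sizeBiasedDensity (degree G)) - 3 := by
  rw [graphRho_eq_sum, counterValue_sizeBiasedDensity]
  simp_rw [hG.counterSurvival_eq hL]

end Disassort

namespace Disassort

/-! ### The countermonotonic coupling -/

/-- The joint distribution function `P(X ≤ k, Y ≤ l)` of the countermonotonic coupling of the
density `p` with itself. -/
noncomputable def counterCdf (p : ℕ → ℝ) (k l : ℕ) : ℝ := max 0 (cumul p k + cumul p l - 1)

/-- Both sides are the length of the intersection of `(1 - a, 1 - a']` with `(b', b]`. This is the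
cell mass when a uniform `U` generates one coordinate and `1 - U` the other; the indicators detect
whether the intervals meet. -/
theorem ite_mul_ite_mul_overlap {a a' b b' : ℝ} (ha : a' ≤ a) (hb : b' ≤ b)
    (u v : ℝ) (hu : u = if 1 - a < b then 1 else 0) (hv : v = if 1 - a' > b' then 1 else 0) :
    u * v * (min (1 - a') b - max (1 - a) b') =
      max 0 (a + b - 1) - max 0 (a' + b - 1) - (max 0 (a + b' - 1) - max 0 (a' + b' - 1)) := by
  subst hu hv
  rcases max_cases 0 (a + b - 1) with h1 | h1 <;> rcases max_cases 0 (a' + b - 1) with h2 | h2 <;>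
  rcases max_cases 0 (a + b' - 1) with h3 | h3 <;>
  rcases max_cases 0 (a' + b' - 1) with h4 | h4 <;>
  rcases min_cases (1 - a') b with h5 | h5 <;> rcases max_cases (1 - a) b' with h6 | h6 <;>
  rw [h1.1, h2.1, h3.1, h4.1, h5.1, h6.1] <;> split_ifs <;> linarith

theorem jointDensity_succ (fs : PMF ℕ) (hp : IsPosDensity (density fs)) (k l : ℕ) :
    jointDensity fs ((k : ℤ) + 1) ((l : ℤ) + 1) =
      counterCdf (density fs) (k + 1) (l + 1) - counterCdf (density fs) k (l + 1) -
        (counterCdf (density fs) (k + 1) l - counterCdf (density fs) k l) := by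
  unfold jointDensity psi overlap counterCdf
  rw [if_pos ⟨by omega, by omega⟩, add_sub_cancel_right, add_sub_cancel_right]
  push_cast
  exact ite_mul_ite_mul_overlap (hp.cumul_mono (by omega)) (hp.cumul_mono (by omega)) _ _ rfl rfl

theorem jointDensity_nonneg (fs : PMF ℕ) (k l : ℤ) : 0 ≤ jointDensity fs k l := by
  have hmono : Monotone (cumul (density fs)) := fun _ _ h =>
    Finset.sum_le_sum_of_subset_of_nonneg (Finset.range_mono (by omega))
      fun _ _ _ => ENNReal.toReal_nonneg
  unfold jointDensity psi overlap
  have h1 : cumul (density fs) (k - 1) ≤ cumul (density fs) k := hmono (by omega)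
  have h2 : cumul (density fs) (l - 1) ≤ cumul (density fs) l := hmono (by omega)
  split_ifs with h h3 h4
  · rw [one_mul, one_mul, sub_nonneg]
    exact max_le (le_min (by linarith) h3.le) (le_min h4.le h2)
  all_goals simp

theorem isPosDensity_density {fs : PMF ℕ} (h0 : fs 0 = 0) : IsPosDensity (density fs) where
  nonneg _ := ENNReal.toReal_nonneg
  zero := by simp [density, h0]
  hasSum := by
    have h := ENNReal.hasSum_toReal (f := fs) (by rw [fs.tsum_coe]; exact ENNReal.one_ne_top)
    rw [← ENNReal.tsum_toReal_eq fs.apply_ne_top, fs.tsum_coe] at h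
    exact h

section

variable {p : ℕ → ℝ}

theorem IsPosDensity.counterCdf_zero_left (hp : IsPosDensity p) (l : ℕ) :
    counterCdf p 0 l = 0 := by
  refine max_eq_left ?_
  have := hp.cumul_le_one l
  simp only [Nat.cast_zero, hp.cumul_zero]
  linarith

theorem counterCdf_comm (p : ℕ → ℝ) (k l : ℕ) : counterCdf p k l = counterCdf p l k := by
  unfold counterCdf
  rw [add_comm (cumul p k)]

theorem IsPosDensity.counterCdf_zero_right (hp : IsPosDensity p) (k : ℕ) :
    counterCdf p k 0 = 0 := by
  rw [counterCdf_comm, hp.counterCdf_zero_left]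

theorem IsPosDensity.tendsto_counterCdf (hp : IsPosDensity p) (k : ℕ) :
    Tendsto (counterCdf p k) atTop (𝓝 (cumul p k)) := by
  have h : Tendsto (counterCdf p k) atTop (𝓝 (max 0 (cumul p k + 1 - 1))) :=
    tendsto_const_nhds.max ((hp.tendsto_cumul.const_add _).sub_const 1)
  rwa [add_sub_cancel_right, max_eq_right (hp.cumul_nonneg k)] at h

end

theorem sum_range_jointDensity (fs : PMF ℕ) (hp : IsPosDensity (density fs)) (k m : ℕ) :
    ∑ l ∈ Finset.range m, jointDensity fs ((k : ℤ) + 1) ((l : ℤ) + 1) =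
      counterCdf (density fs) (k + 1) m - counterCdf (density fs) k m := by
  simp_rw [jointDensity_succ fs hp]
  rw [Finset.sum_range_sub
    fun l => counterCdf (density fs) (k + 1) l - counterCdf (density fs) k l]
  simp [hp.counterCdf_zero_right]

theorem sum_range_sum_range_jointDensity (fs : PMF ℕ) (hp : IsPosDensity (density fs))
    (k m : ℕ) :
    ∑ i ∈ Finset.range k, ∑ l ∈ Finset.range m, jointDensity fs ((i : ℤ) + 1) ((l : ℤ) + 1) =
      counterCdf (density fs) k m := by
  simp_rw [sum_range_jointDensity fs hp]
  rw [Finset.sum_range_sub fun i => counterCdf (density fs) i m]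
  simp [hp.counterCdf_zero_left]

/-- Each row telescopes to a difference of `counterCdf`, whose limit is the marginal mass `density
fs (k + 1)`; these masses sum to 1. -/
theorem hasSum_jointDensity (fs : PMF ℕ) (hp : IsPosDensity (density fs)) :
    HasSum (fun x : ℤ × ℤ => jointDensity fs x.1 x.2) 1 := by
  have hrow : ∀ k : ℕ, HasSum (fun l : ℕ => jointDensity fs ((k : ℤ) + 1) ((l : ℤ) + 1))
      (density fs (k + 1)) := by
    intro k
    rw [hasSum_iff_tendsto_nat_of_nonneg fun _ => jointDensity_nonneg _ _ _]
    simp_rw [sum_range_jointDensity fs hp]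
    have h := (hp.tendsto_counterCdf (k + 1)).sub (hp.tendsto_counterCdf k)
    push_cast at h
    rwa [cumul_natCast_succ, add_sub_cancel_left] at h
  have hsum : Summable fun x : ℕ × ℕ => jointDensity fs ((x.1 : ℤ) + 1) ((x.2 : ℤ) + 1) := by
    rw [summable_prod_of_nonneg fun _ => jointDensity_nonneg _ _ _]
    refine ⟨fun k => (hrow k).summable, ?_⟩
    simp_rw [fun k => (hrow k).tsum_eq]
    exact hp.hasSum_succ.summable
  have h1 : HasSum (fun x : ℕ × ℕ => jointDensity fs ((x.1 : ℤ) + 1) ((x.2 : ℤ) + 1)) 1 := by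
    have := hsum.hasSum.prod_fiberwise hrow
    rw [← this.unique hp.hasSum_succ]
    exact hsum.hasSum
  let e : ℕ × ℕ → ℤ × ℤ := fun x => ((x.1 : ℤ) + 1, (x.2 : ℤ) + 1)
  have he : Function.Injective e := fun x y h => by
    simp only [e, Prod.mk.injEq, add_left_inj, Nat.cast_inj] at h
    exact Prod.ext h.1 h.2
  refine (he.hasSum_iff fun x hx => if_neg fun h => hx ?_).1 h1
  exact ⟨((x.1 - 1).toNat, (x.2 - 1).toNat), Prod.ext (by simp only [e]; omega)
    (by simp only [e]; omega)⟩

/-! ### Random variables with joint density `h` -/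

section

variable {Ω : Type*} [MeasurableSpace Ω] {Q : Measure Ω} [IsProbabilityMeasure Q] {X Y : Ω → ℤ}
  {fs : PMF ℕ}

theorem ae_one_le_of_jointDensity
    (h : ∀ k l : ℤ, Q.real {ω | X ω = k ∧ Y ω = l} = jointDensity fs k l) :
    ∀ᵐ ω ∂Q, 1 ≤ X ω ∧ 1 ≤ Y ω := by
  have h1 : ∀ x : ℤ × ℤ, ∀ᵐ ω ∂Q, X ω = x.1 ∧ Y ω = x.2 → 1 ≤ x.1 ∧ 1 ≤ x.2 := by
    intro x
    by_cases hx : 1 ≤ x.1 ∧ 1 ≤ x.2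
    · exact Eventually.of_forall fun _ _ => hx
    · have h0 := h x.1 x.2
      rw [jointDensity, if_neg hx, measureReal_eq_zero_iff] at h0
      filter_upwards [measure_eq_zero_iff_ae_notMem.1 h0] with ω hω hω'
      exact absurd hω' hω
  filter_upwards [ae_all_iff.2 h1] with ω hω
  exact hω (X ω, Y ω) ⟨rfl, rfl⟩

theorem measureReal_le_le_of_jointDensity (hX : Measurable X) (hY : Measurable Y)
    (hp : IsPosDensity (density fs))
    (h : ∀ k l : ℤ, Q.real {ω | X ω = k ∧ Y ω = l} = jointDensity fs k l) (k l : ℕ) :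
    Q.real {ω | X ω ≤ k ∧ Y ω ≤ l} = counterCdf (density fs) k l := by
  have hae : {ω | X ω ≤ k ∧ Y ω ≤ l} =ᵐ[Q] ⋃ x ∈ Finset.range k ×ˢ Finset.range l,
      {ω | X ω = (x.1 : ℤ) + 1 ∧ Y ω = (x.2 : ℤ) + 1} := by
    filter_upwards [ae_one_le_of_jointDensity h] with ω hω
    refine propext ⟨fun hω' => ?_, fun hω' => ?_⟩
    · change X ω ≤ k ∧ Y ω ≤ l at hω'
      refine Set.mem_iUnion₂.2 ⟨((X ω - 1).toNat, (Y ω - 1).toNat), ?_, ?_⟩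
      · simp only [Finset.mem_product, Finset.mem_range]
        omega
      · simp only [Set.mem_ofPred_eq]
        omega
    · obtain ⟨x, hx, hx'⟩ := Set.mem_iUnion₂.1 hω'
      simp only [Finset.mem_product, Finset.mem_range] at hx
      simp only [Set.mem_ofPred_eq] at hx'
      change X ω ≤ k ∧ Y ω ≤ l
      omega
  rw [measureReal_congr hae, measureReal_biUnion_finset, Finset.sum_product,
    ← sum_range_sum_range_jointDensity fs hp]
  · simp_rw [h]
  · intro x _ y _ hxy
    refine Set.disjoint_left.2 fun ω hx hy => hxy ?_
    simp only [Set.mem_ofPred_eq] at hx hy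
    exact Prod.ext (by omega) (by omega)
  · exact fun x _ => (hX (measurableSet_singleton _)).inter (hY (measurableSet_singleton _))

/-- The joint distribution function increases to the marginal one as the bound on `Y` tends to
infinity. -/
theorem cdfOf_eq_of_jointDensity (hX : Measurable X) (hY : Measurable Y)
    (hp : IsPosDensity (density fs))
    (h : ∀ k l : ℤ, Q.real {ω | X ω = k ∧ Y ω = l} = jointDensity fs k l) :
    cdfOf Q X = cumul (density fs) := by
  have hnat : ∀ k : ℕ, cdfOf Q X k = cumul (density fs) k := by
    intro k
    have hmono : Monotone fun m : ℕ => {ω | X ω ≤ k ∧ Y ω ≤ m} := fun a b hab ω hω =>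
      ⟨hω.1, hω.2.trans (by exact_mod_cast hab)⟩
    have ht := tendsto_measure_iUnion_atTop (μ := Q) hmono
    have hU : ⋃ m : ℕ, {ω | X ω ≤ k ∧ Y ω ≤ m} = {ω | X ω ≤ k} := by
      ext ω
      simp only [Set.mem_iUnion, Set.mem_ofPred_eq]
      exact ⟨fun ⟨_, h⟩ => h.1, fun h => ⟨(Y ω).toNat, h, by omega⟩⟩
    rw [hU] at ht
    have ht' := (ENNReal.tendsto_toReal (measure_ne_top Q _)).comp ht
    have hlim : Tendsto (fun m : ℕ => counterCdf (density fs) k m) atTop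
        (𝓝 (cdfOf Q X k)) := by
      refine ht'.congr fun m => ?_
      exact measureReal_le_le_of_jointDensity hX hY hp h k m
    exact tendsto_nhds_unique hlim (hp.tendsto_counterCdf k)
  ext k
  rcases le_or_gt 0 k with hk | hk
  · lift k to ℕ using hk
    exact hnat k
  · rw [cumul_of_neg _ hk]
    refine le_antisymm ?_ measureReal_nonneg
    have h0 := hnat 0
    simp only [Nat.cast_zero, hp.cumul_zero] at h0
    rw [← h0]
    exact measureReal_mono fun ω hω => le_trans hω hk.le

theorem jointDensity_comm (hp : IsPosDensity (density fs)) (k l : ℤ) :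
    jointDensity fs k l = jointDensity fs l k := by
  by_cases h : 1 ≤ k ∧ 1 ≤ l
  · obtain ⟨k, rfl⟩ : ∃ m : ℕ, k = (m : ℤ) + 1 := ⟨(k - 1).toNat, by omega⟩
    obtain ⟨l, rfl⟩ : ∃ m : ℕ, l = (m : ℤ) + 1 := ⟨(l - 1).toNat, by omega⟩
    rw [jointDensity_succ fs hp, jointDensity_succ fs hp, counterCdf_comm _ k (l + 1),
      counterCdf_comm _ k l, counterCdf_comm _ (k + 1) (l + 1), counterCdf_comm _ (k + 1) l]
    ring
  · rw [jointDensity, jointDensity, if_neg h, if_neg fun h' => h h'.symm]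

theorem measureReal_lt_lt_of_jointDensity (hX : Measurable X) (hY : Measurable Y)
    (hp : IsPosDensity (density fs))
    (h : ∀ k l : ℤ, Q.real {ω | X ω = k ∧ Y ω = l} = jointDensity fs k l)
    (hcX : cdfOf Q X = cumul (density fs)) (hcY : cdfOf Q Y = cumul (density fs)) (x : ℕ × ℕ) :
    Q.real {ω | (x.1 : ℤ) < X ω ∧ (x.2 : ℤ) < Y ω} = counterSurvival (density fs) x := by
  have hmX : MeasurableSet {ω | X ω ≤ x.1} := hX measurableSet_Iic
  have hmY : MeasurableSet {ω | Y ω ≤ x.2} := hY measurableSet_Iic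
  have hs : {ω | (x.1 : ℤ) < X ω ∧ (x.2 : ℤ) < Y ω} = ({ω | X ω ≤ x.1} ∪ {ω | Y ω ≤ x.2})ᶜ := by
    ext ω
    simp
  have h1 := measureReal_union_add_inter (μ := Q) (s := {ω | X ω ≤ x.1}) hmY
  have h2 : Q.real ({ω | X ω ≤ x.1} ∩ {ω | Y ω ≤ x.2}) = _ :=
    measureReal_le_le_of_jointDensity hX hY hp h x.1 x.2
  have h3 : Q.real {ω | X ω ≤ x.1} = _ := congrFun hcX x.1
  have h4 : Q.real {ω | Y ω ≤ x.2} = _ := congrFun hcY x.2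
  rw [hs, probReal_compl_eq_one_sub (hmX.union hmY)]
  rw [h2, h3, h4, counterCdf] at h1
  unfold counterSurvival
  rcases max_cases 0 (cumul (density fs) x.1 + cumul (density fs) x.2 - 1) with h5 | h5 <;>
  rcases max_cases 0 (1 - cumul (density fs) x.1 - cumul (density fs) x.2) with h6 | h6 <;>
  linarith

/-- Hoeffding's identity again, now with an infinite sum exchanged with the integral by summability
of the norms. -/
theorem spearmanRho_eq_of_jointDensity (hX : Measurable X) (hY : Measurable Y)
    (hp : IsPosDensity (density fs))
    (h : ∀ k l : ℤ, Q.real {ω | X ω = k ∧ Y ω = l} = jointDensity fs k l) :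
    spearmanRho Q X Y = 3 * counterValue (density fs) - 3 := by
  have hcX := cdfOf_eq_of_jointDensity hX hY hp h
  have hcY := cdfOf_eq_of_jointDensity (Q := Q) (X := Y) (Y := X) hY hX hp fun k l => by
    rw [jointDensity_comm hp, ← h]
    simp_rw [and_comm]
  set p := density fs
  let S : ℕ × ℕ → Set Ω := fun x => {ω | (x.1 : ℤ) < X ω ∧ (x.2 : ℤ) < Y ω}
  let F : ℕ × ℕ → Ω → ℝ := fun x => (S x).indicator fun _ => midIncr p x.1 * midIncr p x.2
  have hS : ∀ x, MeasurableSet (S x) := fun x =>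
    (hX measurableSet_Ioi).inter (hY measurableSet_Ioi)
  have hF : ∀ x ω, 0 ≤ F x ω := fun x ω =>
    Set.indicator_nonneg (fun _ _ => mul_nonneg (hp.midIncr_nonneg _) (hp.midIncr_nonneg _)) ω
  have hint : ∀ x, Integrable (F x) Q := fun x => (integrable_const _).indicator (hS x)
  have hval : ∀ x, ∫ ω, F x ω ∂Q = midIncr p x.1 * midIncr p x.2 * counterSurvival p x := by
    intro x
    rw [integral_indicator_const _ (hS x), smul_eq_mul, mul_comm,
      measureReal_lt_lt_of_jointDensity hX hY hp h hcX hcY]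
  have hnorm : Summable fun x => ∫ ω, ‖F x ω‖ ∂Q := by
    simp_rw [fun x ω => Real.norm_of_nonneg (hF x ω), hval]
    exact hp.summable_counterValue
  have hsum := (hasSum_integral_of_summable_integral_norm hint hnorm).tsum_eq
  simp_rw [hval] at hsum
  unfold spearmanRho
  rw [hcX, hcY, counterValue, hsum]
  congr 2
  refine integral_congr_ae ?_
  filter_upwards [ae_one_le_of_jointDensity h] with ω hω
  obtain ⟨k, hk⟩ := Int.eq_ofNat_of_zero_le (show 0 ≤ X ω by omega)
  obtain ⟨l, hl⟩ := Int.eq_ofNat_of_zero_le (show 0 ≤ Y ω by omega)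
  rw [hk, hl, midRank_cumul p hp.zero, midRank_cumul p hp.zero, Finset.sum_mul_sum,
    ← Finset.sum_product', tsum_eq_sum (s := Finset.range k ×ˢ Finset.range l)]
  · refine Finset.sum_congr rfl fun x hx => ?_
    simp only [Finset.mem_product, Finset.mem_range] at hx
    have : ω ∈ S x := by
      simp only [S, Set.mem_ofPred_eq]
      omega
    simp only [F, Set.indicator_of_mem this]
  · intro x hx
    simp only [Finset.mem_product, Finset.mem_range] at hx
    have : ω ∉ S x := by
      simp only [S, Set.mem_ofPred_eq]
      omega
    simp only [F, Set.indicator_of_notMem this]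

end

end Disassort

namespace Disassort

/-! ### The Disassortative Graph Algorithm -/

/-! ### Splitting and zipping sorted lists -/

section

variable {α : Type*}

theorem exists_append_of_pairwise (q : α → Prop) {l : List α}
    (h : l.Pairwise fun a b => q b → q a) :
    ∃ l₁ l₂, l = l₁ ++ l₂ ∧ (∀ a ∈ l₁, q a) ∧ ∀ a ∈ l₂, ¬ q a := by
  induction l with
  | nil => exact ⟨[], [], by simp⟩
  | cons a l ih =>
    rw [List.pairwise_cons] at h
    by_cases ha : q a
    · obtain ⟨l₁, l₂, rfl, h₁, h₂⟩ := ih h.2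
      exact ⟨a :: l₁, l₂, rfl, by simpa using ⟨ha, h₁⟩, h₂⟩
    · refine ⟨[], a :: l, rfl, by simp, ?_⟩
      rintro b (_ | ⟨_, hb⟩)
      · exact ha
      · exact fun hq => ha (h.1 b hb hq)

theorem takeWhile_eq_nil_of_forall_not {p : α → Bool} {l : List α} (h : ∀ a ∈ l, p a = false) :
    l.takeWhile p = [] := by
  cases l with
  | nil => rfl
  | cons a l => rw [List.takeWhile_cons, h a List.mem_cons_self]; rfl

theorem pairwise_zip {β : Type*} {R : α → α → Prop} {R' : β → β → Prop} {l : List α} {l' : List β}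
    (h : l.Pairwise R) (h' : l'.Pairwise R') :
    (l.zip l').Pairwise fun a b => R a.1 b.1 ∧ R' a.2 b.2 := by
  induction l generalizing l' with
  | nil => simp
  | cons a l ih =>
    cases l' with
    | nil => simp
    | cons b l' =>
      rw [List.pairwise_cons] at h h'
      rw [List.zip_cons_cons, List.pairwise_cons]
      refine ⟨fun c hc => ?_, ih h.2 h'.2⟩
      obtain ⟨h1, h2⟩ := List.of_mem_zip (a := c.1) (b := c.2) hc
      exact ⟨h.1 _ h1, h'.1 _ h2⟩

/-- The first pair with both degrees `z` can only occur once both `S₁` and `T₁` are exhausted. Until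
then the shorter of the two is padded with stubs of degree `z`; the length hypotheses ensure that
neither list ends earlier. -/
theorem exists_takeWhile_zip_eq (D : α → ℕ) (z : ℕ) {S₁ S₂ T₁ T₂ : List α}
    (hS₁ : ∀ a ∈ S₁, z < D a) (hS₂ : ∀ a ∈ S₂, D a = z)
    (hT₁ : ∀ a ∈ T₁, D a < z) (hT₂ : ∀ a ∈ T₂, D a = z)
    (hTS : T₁.length ≤ (S₁ ++ S₂).length) (hST : S₁.length ≤ (T₁ ++ T₂).length) :
    ∃ U V : List α, U.Sublist S₂ ∧ V.Sublist T₂ ∧ (U = [] ∨ V = []) ∧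
      (S₁ ++ U).length = (T₁ ++ V).length ∧
      (List.zip (S₁ ++ S₂) (T₁ ++ T₂)).takeWhile
        (fun a => !decide (D a.1 = z ∧ D a.2 = z)) = List.zip (S₁ ++ U) (T₁ ++ V) := by
  -- Truncated subtraction makes at least one of the paddings `U`, `V` empty.
  set U := S₂.take (T₁.length - S₁.length) with hU
  set V := T₂.take (S₁.length - T₁.length) with hV
  set U' := S₂.drop (T₁.length - S₁.length)
  set V' := T₂.drop (S₁.length - T₁.length)
  have hUU : S₂ = U ++ U' := (List.take_append_drop _ _).symm
  have hVV : T₂ = V ++ V' := (List.take_append_drop _ _).symm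
  have hlen : (S₁ ++ U).length = (T₁ ++ V).length := by
    simp only [List.length_append, hU, hV, List.length_take] at *
    omega
  have hor : U = [] ∨ V = [] := by
    rcases le_total T₁.length S₁.length with h | h
    · left; rw [hU, Nat.sub_eq_zero_of_le h, List.take_zero]
    · right; rw [hV, Nat.sub_eq_zero_of_le h, List.take_zero]
  refine ⟨U, V, List.take_sublist _ _, List.take_sublist _ _, hor, hlen, ?_⟩
  have hsplit : List.zip (S₁ ++ S₂) (T₁ ++ T₂) =
      List.zip (S₁ ++ U) (T₁ ++ V) ++ List.zip U' V' := by
    rw [← List.zip_append hlen, List.append_assoc, List.append_assoc, ← hUU, ← hVV]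
  rw [hsplit, List.takeWhile_append_of_pos, takeWhile_eq_nil_of_forall_not, List.append_nil]
  · intro a ha
    obtain ⟨h1, h2⟩ := List.of_mem_zip (a := a.1) (b := a.2) ha
    simpa using ⟨hS₂ _ (List.mem_of_mem_drop h1), hT₂ _ (List.mem_of_mem_drop h2)⟩
  · intro a ha
    obtain ⟨h1, h2⟩ := List.of_mem_zip (a := a.1) (b := a.2) ha
    simp only [Bool.not_eq_true', decide_eq_false_iff_not]
    rintro ⟨h3, h4⟩
    rcases hor with h | h
    · rw [h, List.append_nil] at h1
      exact (hS₁ _ h1).ne' h3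
    · rw [h, List.append_nil] at h2
      exact (hT₁ _ h2).ne h4

end

variable {n : ℕ}

/-! ### Stub counts, the median degree and the structure of outputs -/

theorem degree_zero (i : Fin n) : degree (0 : Multigraph n) i = 0 := by
  simp [degree, dirEdges]

theorem degree_singleton (a b i : Fin n) :
    degree ({s(a, b)} : Multigraph n) i = [a].count i + [b].count i := by
  unfold degree dirEdges
  rw [Multiset.singleton_bind, biEdges_mk]
  simp only [Multiset.insert_eq_cons, Multiset.map_cons, Multiset.map_singleton,
    Multiset.count_cons, Multiset.count_singleton, List.count_singleton, beq_iff_eq,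
    eq_comm (a := i)]
  ring

theorem degree_coe_map_mk (l : List (Fin n × Fin n)) (i : Fin n) :
    degree ((l.map fun a => s(a.1, a.2) : List (Sym2 (Fin n))) : Multigraph n) i =
      (l.map Prod.fst).count i + (l.map Prod.snd).count i := by
  induction l with
  | nil => exact degree_zero i
  | cons a l ih =>
    rw [List.map_cons, ← Multiset.cons_coe, ← Multiset.singleton_add, degree_add, ih,
      degree_singleton]
    simp only [List.map_cons, List.count_cons, List.count_nil]
    ring

theorem length_eq_sum_count (l : List (Fin n)) : l.length = ∑ i, l.count i := by
  have := Multiset.sum_count_eq_card (s := Finset.univ) (m := (l : Multiset (Fin n)))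
    fun _ _ => Finset.mem_univ _
  simpa using this.symm

theorem count_flatMap_replicate (D : Fin n → ℕ) (l : List (Fin n)) (v : Fin n) :
    (l.flatMap fun u => List.replicate (D u) u).count v = l.count v * D v := by
  induction l with
  | nil => simp
  | cons a l ih =>
    rw [List.flatMap_cons, List.count_append, ih, List.count_cons, List.count_replicate]
    by_cases h : a = v
    · subst h; simp; ring
    · simp [h]

theorem count_leftStubs (D : Fin n → ℕ) (φ : Equiv.Perm (Fin n)) (z : ℕ) (v : Fin n) :
    (leftStubs D φ z).count v = if z ≤ D v then D v else 0 := by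
  have hnd : (((List.finRange n).reverse.map φ).filter fun v => decide (z ≤ D v)).Nodup :=
    (((List.nodup_reverse.2 (List.nodup_finRange n)).map φ.injective).filter _)
  have hmem : v ∈ (List.finRange n).reverse.map φ :=
    List.mem_map.2 ⟨φ.symm v, by simp, by simp⟩
  unfold leftStubs
  rw [count_flatMap_replicate, hnd.count]
  simp only [List.mem_filter, hmem, true_and, decide_eq_true_eq, ite_mul, one_mul, zero_mul]

theorem count_flatMap_range (D : Fin n → ℕ) (φ : Equiv.Perm (Fin n)) (m : ℕ) (v : Fin n) :
    ((List.range m).flatMap fun d => (List.replicate d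
      (((List.finRange n).map φ).filter fun v => D v = d)).flatten).count v =
      if D v < m then D v else 0 := by
  induction m with
  | zero => simp
  | succ m ih =>
    have hnd : (((List.finRange n).map φ).filter fun v => decide (D v = m)).Nodup :=
      (((List.nodup_finRange n).map φ.injective).filter _)
    have hmem : v ∈ (List.finRange n).map φ := List.mem_map.2 ⟨φ.symm v, by simp, by simp⟩
    rw [List.range_succ, List.flatMap_append, List.count_append, ih, List.flatMap_singleton,
      List.count_flatten, List.map_replicate, List.sum_replicate, hnd.count]
    simp only [List.mem_filter, hmem, true_and, decide_eq_true_eq, smul_eq_mul]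
    split_ifs <;> omega

theorem count_rightStubs (D : Fin n → ℕ) (φ : Equiv.Perm (Fin n)) (z : ℕ) (v : Fin n) :
    (rightStubs D φ z).count v = if D v ≤ z then D v else 0 := by
  have := count_flatMap_range D φ (z + 1) v
  simp only [Nat.lt_succ_iff] at this
  exact this

theorem pairwise_leftStubs {D : Fin n → ℕ} {φ : Equiv.Perm (Fin n)} (hφ : Monotone (D ∘ φ))
    (z : ℕ) : (leftStubs D φ z).Pairwise fun a b => D b ≤ D a := by
  unfold leftStubs
  rw [List.pairwise_flatMap]
  refine ⟨fun v _ => List.pairwise_replicate.2 (Or.inr le_rfl), ?_⟩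
  have h1 : ((List.finRange n).reverse.map φ).Pairwise fun a b => D b ≤ D a := by
    rw [List.pairwise_map, List.pairwise_reverse]
    exact (List.pairwise_lt_finRange n).imp fun h => hφ h.le
  refine (h1.filter _).imp fun {a b} h x hx y hy => ?_
  rw [List.eq_of_mem_replicate hx, List.eq_of_mem_replicate hy]
  exact h

theorem pairwise_rightStubs (D : Fin n → ℕ) (φ : Equiv.Perm (Fin n)) (z : ℕ) :
    (rightStubs D φ z).Pairwise fun a b => D a ≤ D b := by
  have hmem : ∀ d, ∀ v ∈ (List.replicate d
      (((List.finRange n).map φ).filter fun v => D v = d)).flatten, D v = d := by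
    intro d v hv
    obtain ⟨l, hl, hv⟩ := List.mem_flatten.1 hv
    rw [List.eq_of_mem_replicate hl] at hv
    simpa using (List.mem_filter.1 hv).2
  unfold rightStubs
  rw [List.pairwise_flatMap]
  refine ⟨fun d _ => List.pairwise_of_forall_mem_list fun a ha b hb => ?_,
    List.pairwise_lt_range.imp fun h x hx y hy => ?_⟩
  · rw [hmem _ _ ha, hmem _ _ hb]
  · rw [hmem _ _ hx, hmem _ _ hy]
    exact h.le

theorem sum_range_mul_numNodes (D : Fin n → ℕ) (m : ℕ) :
    ∑ t ∈ Finset.range m, (t : ℝ) * numNodes D t =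
      ((∑ i, if D i < m then D i else 0 : ℕ) : ℝ) := by
  unfold numNodes
  simp_rw [Finset.card_filter]
  push_cast
  simp_rw [Finset.mul_sum]
  rw [Finset.sum_comm]
  refine Finset.sum_congr rfl fun i _ => ?_
  simp_rw [mul_ite, mul_one, mul_zero]
  rw [Finset.sum_ite_eq]
  simp

theorem totalDegree_le_two_mul_sum_le (D : Fin n → ℕ) :
    totalDegree D ≤ 2 * ∑ i, if D i ≤ medianDegree D then D i else 0 := by
  have hne : {z : ℕ | (totalDegree D : ℝ) / 2 ≤
      ∑ t ∈ Finset.range (z + 1), (t : ℝ) * numNodes D t}.Nonempty := by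
    refine ⟨totalDegree D, ?_⟩
    rw [Set.mem_ofPred_eq, sum_range_mul_numNodes]
    simp_rw [if_pos (Nat.lt_succ_iff.2 (degree_le_totalDegree D _))]
    rw [← totalDegree]
    exact half_le_self (Nat.cast_nonneg _)
  have h := Nat.sInf_mem hne
  rw [← medianDegree, Set.mem_ofPred_eq, sum_range_mul_numNodes] at h
  simp_rw [Nat.lt_succ_iff] at h
  rw [div_le_iff₀ two_pos, mul_comm] at h
  exact_mod_cast h

theorem two_mul_sum_lt_le_totalDegree (D : Fin n → ℕ) :
    2 * ∑ i, (if D i < medianDegree D then D i else 0) ≤ totalDegree D := by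
  rcases Nat.eq_zero_or_pos (medianDegree D) with h0 | h0
  · simp [h0]
  · have h := Nat.notMem_of_lt_sInf (show medianDegree D - 1 < _ from Nat.sub_lt h0 one_pos)
    rw [Set.mem_ofPred_eq, sum_range_mul_numNodes, Nat.sub_add_cancel h0, not_le,
      lt_div_iff₀ two_pos, mul_comm] at h
    exact_mod_cast h.le

/-- Sorting gives the opposite order of the pairs. The last two clauses control the remaining stubs:
no node is overused, and only nodes of the median degree can have stubs left. -/
theorem pairedEdges_eq {D : Fin n → ℕ} {φ : Equiv.Perm (Fin n)} (hφ : Monotone (D ∘ φ)) :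
    ∃ l : List (Fin n × Fin n),
      pairedEdges D φ (medianDegree D) = (l.map fun a => s(a.1, a.2) : List (Sym2 (Fin n))) ∧
      (∀ a ∈ l, medianDegree D ≤ D a.1 ∧ D a.2 ≤ medianDegree D) ∧
      (l.Pairwise fun a b => D b.1 ≤ D a.1 ∧ D a.2 ≤ D b.2) ∧
      (∀ v, degree (pairedEdges D φ (medianDegree D)) v ≤ D v) ∧
      ∀ v, D v ≠ medianDegree D → degree (pairedEdges D φ (medianDegree D)) v = D v := by
  set z := medianDegree D with hz
  have hS := pairwise_leftStubs hφ z
  have hT := pairwise_rightStubs D φ z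
  have hcS := count_leftStubs D φ z
  have hcT := count_rightStubs D φ z
  have hSz : ∀ a ∈ leftStubs D φ z, z ≤ D a := fun a ha => by
    by_contra h
    exact (List.count_pos_iff.2 ha).ne' (by rw [hcS, if_neg h])
  have hTz : ∀ a ∈ rightStubs D φ z, D a ≤ z := fun a ha => by
    by_contra h
    exact (List.count_pos_iff.2 ha).ne' (by rw [hcT, if_neg h])
  have hlS := length_eq_sum_count (leftStubs D φ z)
  have hlT := length_eq_sum_count (rightStubs D φ z)
  simp_rw [hcS] at hlS
  simp_rw [hcT] at hlT
  have hpair : pairedEdges D φ z = (((List.zip (leftStubs D φ z) (rightStubs D φ z)).takeWhile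
      fun a => !decide (D a.1 = z ∧ D a.2 = z)).map fun a => s(a.1, a.2) : List (Sym2 (Fin n))) :=
    rfl
  have hpw := (pairwise_zip hS hT).sublist (List.takeWhile_sublist
    (l := List.zip (leftStubs D φ z) (rightStubs D φ z)) fun a => !decide (D a.1 = z ∧ D a.2 = z))
  obtain ⟨S₁, S₂, hSS, hS₁, hS₂⟩ := exists_append_of_pairwise (fun a => z < D a)
    (hS.imp fun {a b} h h' => h'.trans_le h)
  obtain ⟨T₁, T₂, hTT, hT₁, hT₂⟩ := exists_append_of_pairwise (fun a => D a < z)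
    (hT.imp fun {a b} h h' => h.trans_lt h')
  rw [hSS] at hSz hcS hlS
  rw [hTT] at hTz hcT hlT
  rw [hSS, hTT] at hpair hpw
  have hS₂' : ∀ a ∈ S₂, D a = z := fun a ha =>
    le_antisymm (not_lt.1 (hS₂ a ha)) (hSz a (List.mem_append_right _ ha))
  have hT₂' : ∀ a ∈ T₂, D a = z := fun a ha =>
    le_antisymm (hTz a (List.mem_append_right _ ha)) (not_lt.1 (hT₂ a ha))
  have hcS₁ : ∀ v, S₁.count v = if z < D v then D v else 0 := by
    intro v
    have h := hcS v
    rw [List.count_append] at h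
    split_ifs with hv
    · rw [if_pos hv.le, List.count_eq_zero.2 fun hm => hS₂ v hm hv] at h
      exact h
    · exact List.count_eq_zero.2 fun hm => hv (hS₁ v hm)
  have hcT₁ : ∀ v, T₁.count v = if D v < z then D v else 0 := by
    intro v
    have h := hcT v
    rw [List.count_append] at h
    split_ifs with hv
    · rw [if_pos hv.le, List.count_eq_zero.2 fun hm => hT₂ v hm hv] at h
      exact h
    · exact List.count_eq_zero.2 fun hm => hv (hT₁ v hm)
  have hlS₁ := length_eq_sum_count S₁
  have hlT₁ := length_eq_sum_count T₁
  simp_rw [hcS₁] at hlS₁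
  simp_rw [hcT₁] at hlT₁
  have hm1 := totalDegree_le_two_mul_sum_le D
  have hm2 := two_mul_sum_lt_le_totalDegree D
  rw [← hz] at hm1 hm2
  have hsplit1 : totalDegree D =
      (∑ i, if D i < z then D i else 0) + ∑ i, if z ≤ D i then D i else 0 := by
    rw [← Finset.sum_add_distrib]
    exact Finset.sum_congr rfl fun i _ => by split_ifs <;> omega
  have hsplit2 : totalDegree D =
      (∑ i, if z < D i then D i else 0) + ∑ i, if D i ≤ z then D i else 0 := by
    rw [← Finset.sum_add_distrib]
    exact Finset.sum_congr rfl fun i _ => by split_ifs <;> omega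
  obtain ⟨U, V, hU, hV, hUV, hlen, hzip⟩ := exists_takeWhile_zip_eq D z hS₁ hS₂' hT₁ hT₂'
    (by rw [hlS, hlT₁]; omega) (by rw [hlT, hlS₁]; omega)
  rw [hzip] at hpair hpw
  have hdeg : ∀ v, degree (pairedEdges D φ z) v = (S₁ ++ U).count v + (T₁ ++ V).count v := by
    intro v
    rw [hpair, degree_coe_map_mk, List.map_fst_zip hlen.le, List.map_snd_zip hlen.ge]
  refine ⟨_, hpair, fun a ha => ?_, hpw, fun v => ?_, fun v hv => ?_⟩
  · obtain ⟨h1, h2⟩ := List.of_mem_zip (a := a.1) (b := a.2) ha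
    exact ⟨hSz _ (((List.Sublist.refl _).append hU).subset h1),
      hTz _ (((List.Sublist.refl _).append hV).subset h2)⟩
  · rw [hdeg, List.count_append, List.count_append]
    have h1 := hcS v
    have h2 := hcT v
    rw [List.count_append] at h1 h2
    have h3 := hU.count_le v
    have h4 := hV.count_le v
    have h5 : U.count v = 0 ∨ V.count v = 0 := by
      rcases hUV with rfl | rfl <;> simp
    rw [hcS₁] at h1 ⊢
    rw [hcT₁] at h2 ⊢
    split_ifs at h1 h2 ⊢ <;> omega
  · rw [hdeg, List.count_append, List.count_append, hcS₁, hcT₁,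
      List.count_eq_zero.2 fun hm => hv (hS₂' v (hU.subset hm)),
      List.count_eq_zero.2 fun hm => hv (hT₂' v (hV.subset hm))]
    split_ifs <;> omega

theorem IsDGAOutput.degree_eq {D : Fin n → ℕ} {H : Multigraph n} (h : IsDGAOutput D H) :
    degree H = D := by
  obtain ⟨φ, -, R, hR, rfl⟩ := h
  ext i
  rw [degree_add, hR]

theorem mem_dirEdges_coe_map_mk {l : List (Fin n × Fin n)} {a : Fin n × Fin n}
    (h : a ∈ dirEdges ((l.map fun a => s(a.1, a.2) : List (Sym2 (Fin n))) : Multigraph n)) :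
    a ∈ l ∨ a.swap ∈ l := by
  obtain ⟨e, he, ha⟩ := Multiset.mem_bind.1 h
  obtain ⟨b, hb, rfl⟩ := List.mem_map.1 (Multiset.mem_coe.1 he)
  rw [biEdges_mk] at ha
  simp only [Multiset.insert_eq_cons, Multiset.mem_cons, Multiset.mem_singleton] at ha
  rcases ha with rfl | rfl
  · exact Or.inl hb
  · exact Or.inr hb

theorem degree_fst_pos {G : Multigraph n} {a : Fin n × Fin n} (h : a ∈ dirEdges G) :
    0 < degree G a.1 :=
  Multiset.count_pos.2 (Multiset.mem_map_of_mem _ h)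

/-- Paired edges are oppositely sorted among themselves. A paired edge and a reversed one lie on
opposite sides of `(z, z)`, where all leftover edges sit. -/
theorem IsDGAOutput.oppositelyOrdered {D : Fin n → ℕ} {H : Multigraph n}
    (h : IsDGAOutput D H) : OppositelyOrdered H := by
  have hdeg := h.degree_eq
  obtain ⟨φ, hφ, R, hR, rfl⟩ := h
  obtain ⟨l, hl, hlz, hpw, -, hne⟩ := pairedEdges_eq hφ
  set z := medianDegree D
  have hRz : ∀ a ∈ dirEdges R, D a.1 = z ∧ D a.2 = z := by
    have h1 : ∀ a ∈ dirEdges R, D a.1 = z := fun a ha => by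
      by_contra hv
      have h1 := degree_fst_pos ha
      have h2 := hR a.1
      rw [hne _ hv] at h2
      omega
    exact fun a ha => ⟨h1 a ha, h1 (a.2, a.1) (swap_mem_dirEdges ha)⟩
  have hsymm : ∀ a ∈ l, ∀ b ∈ l, (D b.1 ≤ D a.1 ∧ D a.2 ≤ D b.2) ∨
      (D a.1 ≤ D b.1 ∧ D b.2 ≤ D a.2) := by
    -- Symmetrising the comparison removes the dependence on list positions.
    let r : Fin n × Fin n → Fin n × Fin n → Prop := fun a b =>
      (D b.1 ≤ D a.1 ∧ D a.2 ≤ D b.2) ∨ (D a.1 ≤ D b.1 ∧ D b.2 ≤ D a.2)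
    have : Std.Symm r := ⟨fun _ _ h => h.symm⟩
    have hr : l.Pairwise r := hpw.imp Or.inl
    exact fun a ha b hb =>
      List.Pairwise.forall_of_forall (R := r) (fun _ _ => Or.inl ⟨le_rfl, le_rfl⟩) hr ha hb
  have hmem : ∀ a ∈ dirEdges (pairedEdges D φ z + R),
      a ∈ l ∨ a.swap ∈ l ∨ (D a.1 = z ∧ D a.2 = z) := by
    intro a ha
    rw [dirEdges_add, Multiset.mem_add, hl] at ha
    rcases ha with ha | ha
    · exact (mem_dirEdges_coe_map_mk ha).imp_right Or.inl
    · exact Or.inr (Or.inr (hRz a ha))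
  intro a ha b hb
  rw [hdeg]
  rcases hmem a ha with ha | ha | ha <;> rcases hmem b hb with hb | hb | hb
  · have := hsymm _ ha _ hb; omega
  · have h1 := hlz _ ha; have h2 := hlz _ hb; simp only [Prod.swap] at h2; omega
  · have h1 := hlz _ ha; omega
  · have h1 := hlz _ ha; have h2 := hlz _ hb; simp only [Prod.swap] at h1; omega
  · have := hsymm _ ha _ hb; simp only [Prod.swap] at this; omega
  · have h1 := hlz _ ha; simp only [Prod.swap] at h1; omega
  · have h1 := hlz _ hb; omega
  · have h1 := hlz _ hb; simp only [Prod.swap] at h1; omega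
  · omega

/-! ### Existence of outputs: an even number of leftover stubs can be paired -/

theorem exists_multigraph_degree_eq_count (k : ℕ) (l : List (Fin n)) (hl : l.length = 2 * k) :
    ∃ R : Multigraph n, ∀ i, degree R i = l.count i := by
  induction k generalizing l with
  | zero =>
    rw [List.length_eq_zero_iff.1 hl]
    exact ⟨0, fun i => degree_zero i⟩
  | succ k ih =>
    match l, hl with
    | a :: b :: l, hl =>
      obtain ⟨R, hR⟩ := ih l (by simp only [List.length_cons] at hl; omega)
      refine ⟨{s(a, b)} + R, fun i => ?_⟩
      rw [degree_add, hR, degree_singleton]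
      simp only [List.count_cons, List.count_nil]
      ring

theorem exists_multigraph_degree_eq {r : Fin n → ℕ} (hr : Even (totalDegree r)) :
    ∃ R : Multigraph n, ∀ i, degree R i = r i := by
  have hc : ∀ v, ((List.finRange n).flatMap fun u => List.replicate (r u) u).count v = r v :=
    fun v => by
      rw [count_flatMap_replicate, (List.nodup_finRange n).count, if_pos (List.mem_finRange v),
        one_mul]
  obtain ⟨k, hk⟩ := hr.two_dvd
  obtain ⟨R, hR⟩ := exists_multigraph_degree_eq_count k
    ((List.finRange n).flatMap fun u => List.replicate (r u) u)
    (by rw [length_eq_sum_count]; simp_rw [hc]; exact hk)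
  exact ⟨R, fun i => (hR i).trans (hc i)⟩

theorem even_totalDegree_degree (G : Multigraph n) : Even (totalDegree (degree G)) := by
  rw [← card_dirEdges]
  induction G using Multiset.induction with
  | empty => simp [dirEdges]
  | cons e G ih =>
    rw [← Multiset.singleton_add, dirEdges_add, Multiset.card_add]
    refine Even.add ?_ ih
    induction e with
    | h i j => exact ⟨1, rfl⟩

theorem exists_isDGAOutput {D : Fin n → ℕ} (hD : Even (totalDegree D)) :
    ∃ H : Multigraph n, IsDGAOutput D H := by
  have hφ := Tuple.monotone_sort D
  obtain ⟨-, -, -, -, hle, -⟩ := pairedEdges_eq hφ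
  set P := pairedEdges D (Tuple.sort D) (medianDegree D)
  obtain ⟨R, hR⟩ := exists_multigraph_degree_eq (r := fun i => D i - degree P i) (by
    have hsum : totalDegree (fun i => D i - degree P i) + totalDegree (degree P) =
        totalDegree D := by
      unfold totalDegree
      rw [← Finset.sum_add_distrib]
      exact Finset.sum_congr rfl fun i _ => Nat.sub_add_cancel (hle i)
    rw [← hsum, Nat.even_add] at hD
    exact hD.2 (even_totalDegree_degree P))
  exact ⟨P + R, _, hφ, R, fun i => by rw [hR]; exact Nat.add_sub_cancel' (hle i), rfl⟩

end Disassort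

namespace Disassort

/-! ### Consequences of the convergence assumption -/

section

variable {n : ℕ} {ε : ℝ} {f fs : PMF ℕ} {D : Fin n → ℕ}

theorem Close.tsum_le (h : Close ε f fs D) :
    ∑' k : ℕ, ENNReal.ofReal |sizeBiasedDensity D k - density fs k| ≤
      ENNReal.ofReal ((n : ℝ) ^ (-ε)) :=
  (le_max_right _ _).trans h

theorem Close.apply_zero_le (h : Close ε f fs D) : fs 0 ≤ ENNReal.ofReal ((n : ℝ) ^ (-ε)) := by
  have h1 := (ENNReal.le_tsum 0).trans h.tsum_le
  rwa [sizeBiasedDensity_zero, zero_sub, abs_neg, density,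
    abs_of_nonneg ENNReal.toReal_nonneg, ENNReal.ofReal_toReal (fs.apply_ne_top 0)] at h1

theorem Close.totalDegree_ne_zero (h : Close ε f fs D) (hn : (n : ℝ) ^ (-ε) < 1) :
    totalDegree D ≠ 0 := by
  intro hL
  have h1 := h.tsum_le
  have h2 : ∀ k, ENNReal.ofReal |sizeBiasedDensity D k - density fs k| = fs k := by
    intro k
    -- With `L_n = 0` the convention `1 / 0 = 0` makes the empirical density vanish, at distance 1
    -- from `f^*`.
    rw [sizeBiasedDensity, hL, Nat.cast_zero, div_zero, zero_mul, zero_sub, abs_neg, density,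
      abs_of_nonneg ENNReal.toReal_nonneg, ENNReal.ofReal_toReal (fs.apply_ne_top k)]
  simp_rw [h2] at h1
  rw [fs.tsum_coe, ENNReal.one_le_ofReal] at h1
  linarith

theorem Close.tsum_abs_le (h : Close ε f fs D) (hp : IsPosDensity (density fs))
    (hL : totalDegree D ≠ 0) :
    ∑' k : ℕ, |sizeBiasedDensity D k - density fs k| ≤ (n : ℝ) ^ (-ε) := by
  have h1 := h.tsum_le
  rwa [← ENNReal.ofReal_tsum_of_nonneg (fun _ => abs_nonneg _)
    ((isPosDensity_sizeBiasedDensity hL).summable_abs_sub hp),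
    ENNReal.ofReal_le_ofReal_iff (Real.rpow_nonneg (Nat.cast_nonneg n) _)] at h1

theorem Close.abs_counterValue_sub_le (h : Close ε f fs D) (hp : IsPosDensity (density fs))
    (hL : totalDegree D ≠ 0) :
    |counterValue (sizeBiasedDensity D) - counterValue (density fs)| ≤
      16 * (n : ℝ) ^ (-ε) :=
  ((isPosDensity_sizeBiasedDensity hL).abs_counterValue_sub_le hp).trans
    (mul_le_mul_of_nonneg_left (h.tsum_abs_le hp hL) (by norm_num))

end

theorem tendsto_natCast_rpow_neg {ε : ℝ} (hε : 0 < ε) :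
    Tendsto (fun n : ℕ => (n : ℝ) ^ (-ε)) atTop (𝓝 0) :=
  (tendsto_rpow_neg_atTop hε).comp tendsto_natCast_atTop_atTop

theorem eventually_mul_rpow_neg_le {ε δ K : ℝ} (hδ : δ < ε) (hK : 0 < K) (C : ℝ) :
    ∀ᶠ n : ℕ in atTop, C * (n : ℝ) ^ (-ε) ≤ K * (n : ℝ) ^ (-δ) := by
  have h := (tendsto_natCast_rpow_neg (sub_pos.2 hδ)).const_mul C
  rw [mul_zero] at h
  filter_upwards [h.eventually_le_const hK, eventually_gt_atTop 0] with n hn hn0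
  have hn0' : (0 : ℝ) < n := by exact_mod_cast hn0
  have he : (n : ℝ) ^ (-ε) = (n : ℝ) ^ (-(ε - δ)) * (n : ℝ) ^ (-δ) := by
    rw [← Real.rpow_add hn0']
    congr 1
    ring
  rw [he, ← mul_assoc]
  exact mul_le_mul_of_nonneg_right hn (Real.rpow_nonneg hn0'.le _)

/-- Eventually `Ω_n` has positive probability, hence is nonempty; as `f_n^*(0) = 0`, a single
outcome bounds `fs 0` by `n ^ (-ε)`. -/
theorem InClass.apply_zero {Ω : ℕ → Type*} [∀ n, MeasurableSpace (Ω n)]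
    {P : ∀ n, Measure (Ω n)} {η ε : ℝ} {f fs : PMF ℕ} {G : ∀ n, Ω n → Multigraph n}
    (hG : InClass P η ε f fs G) : fs 0 = 0 := by
  have h1 : ∀ᶠ n : ℕ in atTop, fs 0 ≤ ENNReal.ofReal ((n : ℝ) ^ (-ε)) := by
    filter_upwards [hG.tendsto_one.eventually_const_lt zero_lt_one] with n hn
    obtain ⟨ω, hω⟩ := nonempty_of_measure_ne_zero hn.ne'
    exact Close.apply_zero_le hω
  have h2 := ENNReal.tendsto_ofReal (tendsto_natCast_rpow_neg hG.eps_pos)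
  rw [ENNReal.ofReal_zero] at h2
  exact nonpos_iff_eq_zero.1 (ge_of_tendsto h2 h1)

theorem measurableSet_comp_eq {Ω α β : Type*} [MeasurableSpace Ω] [Countable α] (G : Ω → α)
    (hG : ∀ g, MeasurableSet {ω | G ω = g}) (c : α → β) (b : β) :
    MeasurableSet {ω | c (G ω) = b} := by
  have h : {ω | c (G ω) = b} = ⋃ g ∈ {g | c g = b}, {ω | G ω = g} := by
    ext ω
    simp
  rw [h]
  exact MeasurableSet.biUnion (Set.to_countable _) fun g _ => hG g

instance {n : ℕ} : Countable (Multigraph n) :=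
  have : Countable (Sym2 (Fin n)) := Finite.to_countable
  inferInstanceAs (Countable (Quotient _))

end Disassort

/-! ### Probability bounds and measurable choice of outputs -/

theorem theorem1
    {Ω : ℕ → Type*} [∀ n, MeasurableSpace (Ω n)]
    (P : ∀ n, MeasureTheory.Measure (Ω n)) [∀ n, MeasureTheory.IsProbabilityMeasure (P n)]
    (η ε : ℝ) (f fs : PMF ℕ) (G : ∀ n, Ω n → Disassort.Multigraph n)
    (hG : Disassort.InClass P η ε f fs G) :
    -- `h` is a probability density on pairs of positive integers
    ((∀ k l : ℤ, 0 ≤ Disassort.jointDensity fs k l) ∧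
      HasSum (fun p : ℤ × ℤ => Disassort.jointDensity fs p.1 p.2) 1) ∧
    -- the bounds, for all random variables `X, Y` with joint density `h`
    (∀ {Ω' : Type*} [MeasurableSpace Ω'] (Q : MeasureTheory.Measure Ω')
      [MeasureTheory.IsProbabilityMeasure Q] (X Y : Ω' → ℤ), Measurable X → Measurable Y →
      (∀ k l : ℤ, Q.real {ω | X ω = k ∧ Y ω = l} = Disassort.jointDensity fs k l) →
      ∀ δ K : ℝ, 0 < δ → δ < min ε (1 / 2) → 0 < K →
      -- lower bound
      (fun n : ℕ => 1 - (P n).real {ω | Disassort.graphRho (G n ω) ≥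
            Disassort.spearmanRho Q X Y - K * (n : ℝ) ^ (-δ)})
        =O[Filter.atTop]
        (fun n : ℕ => (n : ℝ) ^ (-ε + (ε + δ) / 2) +
          (P n).real (Disassort.closeEvent ε f fs (G n))ᶜ) ∧
      -- every choice of outputs of the algorithm attains the bound
      (∀ H : ∀ n, Ω n → Disassort.Multigraph n,
        (∀ n (g : Disassort.Multigraph n), MeasurableSet {ω | H n ω = g}) →
        (∀ n, ∀ᵐ ω ∂(P n), Disassort.IsDGAOutput (Disassort.degree (G n ω)) (H n ω)) →
        (∀ n, ∀ᵐ ω ∂(P n), Disassort.degree (H n ω) = Disassort.degree (G n ω)) ∧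
        (fun n : ℕ => (P n).real {ω | |Disassort.graphRho (H n ω) -
            Disassort.spearmanRho Q X Y| > K * (n : ℝ) ^ (-δ)})
          =O[Filter.atTop]
          (fun n : ℕ => (n : ℝ) ^ (-ε + (ε + δ) / 2) +
            (P n).real (Disassort.closeEvent ε f fs (G n))ᶜ))) ∧
    -- such outputs exist
    (∃ H : ∀ n, Ω n → Disassort.Multigraph n,
      (∀ n (g : Disassort.Multigraph n), MeasurableSet {ω | H n ω = g}) ∧
      ∀ n ω, Disassort.IsDGAOutput (Disassort.degree (G n ω)) (H n ω)) := by
  have hp := Disassort.isPosDensity_density hG.apply_zero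
  refine ⟨⟨Disassort.jointDensity_nonneg fs, Disassort.hasSum_jointDensity fs hp⟩, ?_, ?_⟩
  · intro Ω' _ Q _ X Y hX hY h δ K hδ hδ' hK
    rw [Disassort.spearmanRho_eq_of_jointDensity hX hY hp h]
    -- Deterministic on `Ω_n`, uniformly in the degree sequence; 48 is 3 times the Lipschitz
    -- constant 16.
    have hbound : ∀ᶠ n : ℕ in Filter.atTop, ∀ D : Fin n → ℕ, Disassort.Close ε f fs D →
        Disassort.totalDegree D ≠ 0 ∧
        |3 * Disassort.counterValue (Disassort.sizeBiasedDensity D) -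
          3 * Disassort.counterValue (Disassort.density fs)| ≤ K * (n : ℝ) ^ (-δ) := by
      filter_upwards [(Disassort.tendsto_natCast_rpow_neg hG.eps_pos).eventually_lt_const one_pos,
        Disassort.eventually_mul_rpow_neg_le (hδ'.trans_le (min_le_left _ _)) hK 48]
        with n hn hn' D hD
      have hL := hD.totalDegree_ne_zero hn
      refine ⟨hL, ?_⟩
      have := hD.abs_counterValue_sub_le hp hL
      rw [← mul_sub, abs_mul, abs_of_pos (by norm_num : (0 : ℝ) < 3)]
      linarith
    refine ⟨?_, fun H _ hH => ⟨fun n => ?_, ?_⟩⟩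
    · refine Asymptotics.IsBigO.of_bound 1 ?_
      filter_upwards [hbound] with n hn
      have hsub : Disassort.closeEvent ε f fs (G n) ⊆ {ω | Disassort.graphRho (G n ω) ≥
          3 * Disassort.counterValue (Disassort.density fs) - 3 - K * (n : ℝ) ^ (-δ)} := by
        intro ω hω
        obtain ⟨hL, hb⟩ := hn _ hω
        have h1 := Disassort.counterValue_le_graphRho (G n ω) hL
        have h2 := (abs_le.1 hb).1
        change Disassort.graphRho (G n ω) ≥ _
        linarith
      have h1 := MeasureTheory.measureReal_mono (μ := P n) hsub
      have h2 := MeasureTheory.measureReal_union_le (μ := P n)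
        (Disassort.closeEvent ε f fs (G n)) (Disassort.closeEvent ε f fs (G n))ᶜ
      rw [Set.union_compl_self, MeasureTheory.probReal_univ] at h2
      have h3 : 0 ≤ (n : ℝ) ^ (-ε + (ε + δ) / 2) := Real.rpow_nonneg (Nat.cast_nonneg n) _
      have h4 := MeasureTheory.measureReal_nonneg (μ := P n)
        (s := (Disassort.closeEvent ε f fs (G n))ᶜ)
      rw [one_mul, Real.norm_of_nonneg (sub_nonneg.2 MeasureTheory.measureReal_le_one),
        Real.norm_of_nonneg (add_nonneg h3 h4)]
      linarith
    · filter_upwards [hH n] with ω hω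
      exact hω.degree_eq
    · refine Asymptotics.IsBigO.of_bound 1 ?_
      filter_upwards [hbound] with n hn
      have h3 : 0 ≤ (n : ℝ) ^ (-ε + (ε + δ) / 2) := Real.rpow_nonneg (Nat.cast_nonneg n) _
      have h4 := MeasureTheory.measureReal_nonneg (μ := P n)
        (s := (Disassort.closeEvent ε f fs (G n))ᶜ)
      rw [one_mul, Real.norm_of_nonneg MeasureTheory.measureReal_nonneg,
        Real.norm_of_nonneg (add_nonneg h3 h4)]
      -- The probability of the complement of `Ω_n` alone suffices as a bound.
      refine le_trans ?_ (le_add_of_nonneg_left h3)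
      refine ENNReal.toReal_mono (MeasureTheory.measure_ne_top _ _)
        (MeasureTheory.measure_mono_ae ?_)
      filter_upwards [hH n] with ω hω hgt hclose
      have hd := hω.degree_eq
      obtain ⟨hL, hb⟩ := hn _ hclose
      have h1 := hω.oppositelyOrdered.graphRho_eq (by rwa [hd])
      rw [hd] at h1
      change K * (n : ℝ) ^ (-δ) < |Disassort.graphRho (H n ω) - _| at hgt
      rw [h1, sub_sub_sub_cancel_right] at hgt
      exact hgt.not_ge hb
  -- Choosing one output per multigraph, not per outcome, makes it a function of `G n`, hence
  -- measurable because there are countably many multigraphs.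
  · choose c hc using fun n (g : Disassort.Multigraph n) =>
      Disassort.exists_isDGAOutput (Disassort.even_totalDegree_degree g)
    exact ⟨fun n ω => c n (G n ω), fun n =>
      Disassort.measurableSet_comp_eq (G n) (hG.measurable_graph n) (c n), fun n ω => hc n _⟩
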